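/- Setting. Let $K$ be a field of characteristic $0$, $L/K$ a field extension and $\Gamma$ a finite group. A $\otimes$-category is an additive symmetric monoidal category with biadditive tensor product, and a $\otimes$-functor is an additive strong symmetric monoidal functor. Let $\mathcal A,\mathcal A'$ be rigid abelian $K$-linear $\otimes$-categories with $\operatorname{End}(\mathbf 1)=K$. Suppose $\Gamma$ pseudo-acts on $\mathcal A'$ by $\otimes$-functors $g^*$ (with coherent monoidal isomorphisms $h^*g^*\cong (gh)^*$). Let $f^*:\mathcal A\to\mathcal A'$ be a $K$-linear $\otimes$-functor with compatible monoidal isomorphisms $i_g:g^*f^*\cong f^*$, and with a right adjoint $f_*$ (unit $\eta$, counit $\epsilon$). Assume that: * $f^*$ is Cartesian: the morphism $f^*f_*C\to\prod_{g\in\Gamma}g^*C$ with components $g^*(\epsilon_C)\circ i_g^{-1}$ is an isomorphism for all $C\in\mathcal A'$; * $f^*$ has a trace structure: a natural transformation $\operatorname{tr}:f_*f^*\Rightarrow \mathrm{Id}_{\mathcal A}$ such that $\operatorname{tr}_A\circ\eta_A=|\Gamma|\cdot 1_A$ and $f^*(\operatorname{tr}_A)=\sum_{g\in\Gamma}\epsilon_{f^*A}^g$,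 where $\varphi^g=i_g\circ g^*\varphi\circ i_g^{-1}$. Let $\mathcal B$ be another rigid abelian $K$-linear $\otimes$-category with $\operatorname{End}(\mathbf 1)=K$, and let $\gamma:\mathcal A\to\mathcal B$ and $\omega_{\mathcal B}:\mathcal B\to\mathbf{Vec}_L$ be exact faithful $K$-linear $\otimes$-functors, where $\mathbf{Vec}_L$ is the category of finite-dimensional $L$-vector spaces. Let $\omega':\mathcal A'\to\mathbf{Vec}_L$ be an exact faithful $K$-linear $\otimes$-functor, with a monoidal isomorphism $\theta:\omega_{\mathcal B}\gamma\cong\omega'f^*$. Let $R=\gamma(f_*\mathbf 1)$, a commutative monoid of $\mathcal B$, and let the universal extension $\mathcal B'=\mathcal B^R$ be the category of $R$-modules in $\mathcal B$; its tensor product is $\otimes_R$ and its unit object is $R$. The morphisms $\theta$ and $\omega'(\epsilon_{\mathbf 1})$ induce a homomorphism of algebras $\omega_{\mathcal B}(R)\cong\omega'(f^*f_*\mathbf 1)\to\omega'(\mathbf 1)\cong L$; let $$\omega'_{\mathcal B}:\mathcal B'\to\mathbf{Vec}_L,\qquad M\mapsto L\otimes_{\omega_{\mathcal B}(R)}\omega_{\mathcal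 B}(M)$$ be the induced functor, which extends $\omega_{\mathcal B}$ along $X\mapsto R\otimes X$. An Artin object for $f^*$ is an object $A\in\mathcal A$ with $f^*A\cong\mathbf 1^{n}$ for some $n\ge 0$; let $\mathcal A^0(f^*)\subseteq\mathcal A$ be the full subcategory of Artin objects. Proposition. (1) The functor $\omega'_{\mathcal B}$ is faithful if and only if $\mathcal B'$ is connected, i.e. the ring $\operatorname{End}_{\mathcal B'}(R)$ of endomorphisms of its unit object is a field. (2) If the restriction of $\gamma$ to $\mathcal A^0(f^*)$ is full, then $\omega'_{\mathcal B}$ is faithful. (3) If $L=K$ and $\omega'_{\mathcal B}$ is faithful, then the restriction of $\gamma$ to $\mathcal A^0(f^*)$ is full. -/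

import Mathlib

open CategoryTheory CategoryTheory.Limits MonoidalCategory

universe v₁ v₂ v₃ v₄ u₁ u₂ u₃ u₄ w

noncomputable section

/-- A (contravariant) pseudo-action of a group `Γ` on a symmetric monoidal category `C` by strong
symmetric monoidal functors: every `g` gives a tensor functor `g^* = pull g`, with monoidal
isomorphisms `c_{g,h} : h^* g^* ≅ (g h)^*` and `1 ≅ 1^*`, subject to the usual coherence laws of a
pseudo-functor. -/
structure TensorPseudoAction (Γ : Type*) [Group Γ] (C : Type u₂) [Category.{v₂} C]
    [MonoidalCategory C] [SymmetricCategory C] where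
  /-- The functor `g^*`. -/
  pull : Γ → C ⥤ C
  /-- `g^*` is a strong symmetric monoidal functor. -/
  [braided : ∀ g, (pull g).Braided]
  /-- The isomorphism `c_{g,h} : h^* g^* ≅ (g h)^*`. -/
  comp : ∀ g h, pull g ⋙ pull h ≅ pull (g * h)
  /-- The isomorphism between the identity functor and `1^*`. -/
  unit : 𝟭 C ≅ pull 1
  comp_monoidal : ∀ g h, NatTrans.IsMonoidal (comp g h).hom
  unit_monoidal : NatTrans.IsMonoidal unit.hom
  assoc : ∀ (g h k : Γ) (X : C),
    (pull k).map ((comp g h).hom.app X) ≫ (comp (g * h) k).hom.app X =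
      (comp h k).hom.app ((pull g).obj X) ≫ (comp g (h * k)).hom.app X ≫
        eqToHom (by rw [mul_assoc])
  unit_left : ∀ (g : Γ) (X : C),
    (pull g).map (unit.hom.app X) ≫ (comp 1 g).hom.app X = eqToHom (by simp)
  unit_right : ∀ (g : Γ) (X : C),
    unit.hom.app ((pull g).obj X) ≫ (comp g 1).hom.app X = eqToHom (by simp)

attribute [instance] TensorPseudoAction.braided

section Descent

variable {Γ : Type*} [Group Γ]
  {A : Type u₁} [Category.{v₁} A] [MonoidalCategory A] [SymmetricCategory A]
  {A' : Type u₂} [Category.{v₂} A'] [MonoidalCategory A'] [SymmetricCategory A']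

/-- The structure of pseudo-commutation of a tensor functor `F = f^* : A ⥤ A'` with the
pseudo-action of `Γ` on `A'` (and the trivial action on `A`): monoidal natural isomorphisms
`i_g : g^* f^* ≅ f^*`, compatible with the isomorphisms `c_{g,h}`. -/
structure TensorEquivariance (ρ : TensorPseudoAction Γ A') (F : A ⥤ A') [F.Braided] where
  /-- The isomorphism `i_g : g^* f^* ≅ f^*`. -/
  iso : ∀ g, F ⋙ ρ.pull g ≅ F
  iso_monoidal : ∀ g, NatTrans.IsMonoidal (iso g).hom
  iso_mul : ∀ (g h : Γ) (X : A),
    (ρ.comp g h).hom.app (F.obj X) ≫ (iso (g * h)).hom.app X =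
      (ρ.pull h).map ((iso g).hom.app X) ≫ (iso h).hom.app X
  iso_one : ∀ X : A, ρ.unit.hom.app (F.obj X) ≫ (iso 1).hom.app X = 𝟙 (F.obj X)

variable {ρ : TensorPseudoAction Γ A'} {F : A ⥤ A'} [F.Braided] {G : A' ⥤ A}

/-- The action `φ ↦ φ^g = i_g ∘ g^* φ ∘ i_g⁻¹` of `Γ` on the morphisms `f^* X ⟶ f^* Y`. -/
def TensorEquivariance.translate (i : TensorEquivariance ρ F) (g : Γ) {X Y : A}
    (φ : F.obj X ⟶ F.obj Y) : F.obj X ⟶ F.obj Y :=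
  (i.iso g).inv.app X ≫ (ρ.pull g).map φ ≫ (i.iso g).hom.app Y

/-- The component `f^* f_* C ⟶ g^* C` of the base change morphism: the composition of
`i_g⁻¹ : f^* f_* C ⟶ g^* f^* f_* C` and of `g^*` of the counit. -/
def TensorEquivariance.baseChangeComponent (i : TensorEquivariance ρ F) (adj : F ⊣ G) (C : A')
    (g : Γ) : F.obj (G.obj C) ⟶ (ρ.pull g).obj C :=
  (i.iso g).inv.app (G.obj C) ≫ (ρ.pull g).map (adj.counit.app C)

/-- `f^*` is Cartesian if `f^* f_* C ⟶ ∏ g, g^* C` is an isomorphism for every `C`. -/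
def TensorEquivariance.IsCartesian [Finite Γ] [HasFiniteProducts A']
    (i : TensorEquivariance ρ F) (adj : F ⊣ G) : Prop :=
  ∀ C : A', IsIso (Pi.lift fun g : Γ => i.baseChangeComponent adj C g)

/-- A trace structure on `f^*`: a natural transformation `tr : f_* f^* ⟶ 1` such that `tr ∘ η` is
multiplication by the order of `Γ`, and such that `f^* tr` corresponds to the sum map
`⨁ g, f^* X ⟶ f^* X` under the isomorphism `f^* f_* f^* X ≅ ⨁ g, f^* X` with `g`-component the
translate by `g` of the counit. -/
structure TraceStructure [Fintype Γ] [Preadditive A] [Preadditive A']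
    (i : TensorEquivariance ρ F) (adj : F ⊣ G) where
  /-- The trace. -/
  tr : F ⋙ G ⟶ 𝟭 A
  unit_tr : ∀ X : A, adj.unit.app X ≫ tr.app X = Fintype.card Γ • 𝟙 X
  map_tr : ∀ X : A, F.map (tr.app X) =
    ∑ g : Γ, i.translate g (X := G.obj (F.obj X)) (Y := X) (adj.counit.app (F.obj X))

/-- Artin objects for `f^*`: the objects `X` such that `f^* X` is isomorphic to a finite direct
sum of copies of the unit object. -/
def artinObjects [Preadditive A'] [HasFiniteProducts A'] (F : A ⥤ A') : ObjectProperty A :=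
  haveI : HasFiniteBiproducts A' := HasFiniteBiproducts.of_hasFiniteProducts
  fun X => ∃ n : ℕ, Nonempty (F.obj X ≅ ⨁ fun _ : Fin n => 𝟙_ A')

end Descent

section Modules

variable {B : Type u₁} [Category.{v₁} B] [MonoidalCategory B]
  {C : Type u₂} [Category.{v₂} C] [MonoidalCategory C]

open scoped MonObj

lemma modSmulHom {R : B} [MonObj R] {M N : Mod B R} (f : M ⟶ N) :
    ModObj.smul (M := R) (X := M.X) ≫ f.hom = R ◁ f.hom ≫ ModObj.smul (M := R) (X := N.X) :=
  IsModHom.smul_hom (A := R) (f := f.hom)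

section Preadditive

variable [Preadditive B] [MonoidalPreadditive B] {R : B} [MonObj R]

instance (M N : Mod B R) : Zero (M ⟶ N) :=
  ⟨Mod.Hom.mk' 0 (by
    change _ = R ◁ (0 : M.X ⟶ N.X) ≫ _
    simp)⟩

instance (M N : Mod B R) : Add (M ⟶ N) :=
  ⟨fun f g => Mod.Hom.mk' (f.hom + g.hom) (by
    change _ = R ◁ (f.hom + g.hom) ≫ _
    simp [MonoidalPreadditive.whiskerLeft_add, modSmulHom f, modSmulHom g])⟩

instance (M N : Mod B R) : Neg (M ⟶ N) :=
  ⟨fun f => Mod.Hom.mk' (-f.hom) (by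
    change _ = R ◁ (-f.hom) ≫ _
    rw [show R ◁ (-f.hom) = -(R ◁ f.hom) from
      ((tensoringLeft B).obj R).map_neg (f := f.hom)]
    simp [modSmulHom f])⟩

/-- Morphisms of modules over a monoid are added in the ambient category. -/
instance modHomAddCommGroup (M N : Mod B R) : AddCommGroup (M ⟶ N) where
  add_assoc f g h := Mod.hom_ext _ _ (add_assoc f.hom g.hom h.hom)
  zero_add f := Mod.hom_ext _ _ (zero_add f.hom)
  add_zero f := Mod.hom_ext _ _ (add_zero f.hom)
  nsmul := nsmulRec
  zsmul := zsmulRec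
  neg_add_cancel f := Mod.hom_ext _ _ (neg_add_cancel f.hom)
  add_comm f g := Mod.hom_ext _ _ (add_comm f.hom g.hom)

instance modPreadditive : Preadditive (Mod B R) where
  homGroup := modHomAddCommGroup
  add_comp _ _ _ f f' g := Mod.hom_ext _ _ (Preadditive.add_comp _ _ _ f.hom f'.hom g.hom)
  comp_add _ _ _ f g g' := Mod.hom_ext _ _ (Preadditive.comp_add _ _ _ f.hom g.hom g'.hom)

end Preadditive

lemma modMap_one_smul (W : B ⥤ C) [W.LaxMonoidal] (R X : B) [MonObj R] [ModObj R X] :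
    (Functor.LaxMonoidal.ε W ≫ W.map η[R]) ▷ W.obj X ≫
      Functor.LaxMonoidal.μ W R X ≫ W.map (ModObj.smul (M := R) (X := X)) =
        (λ_ (W.obj X)).hom := by
  rw [comp_whiskerRight, Category.assoc, Functor.LaxMonoidal.μ_natural_left_assoc, ← W.map_comp,
    ModObj.one_smul_self]
  simp

lemma modMap_mul_smul (W : B ⥤ C) [W.LaxMonoidal] (R X : B) [MonObj R] [ModObj R X] :
    (Functor.LaxMonoidal.μ W R R ≫ W.map μ[R]) ▷ W.obj X ≫
      Functor.LaxMonoidal.μ W R X ≫ W.map (ModObj.smul (M := R) (X := X)) =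
    (α_ (W.obj R) (W.obj R) (W.obj X)).hom ≫
      W.obj R ◁ (Functor.LaxMonoidal.μ W R X ≫ W.map (ModObj.smul (M := R) (X := X))) ≫
        Functor.LaxMonoidal.μ W R X ≫ W.map (ModObj.smul (M := R) (X := X)) := by
  simp only [comp_whiskerRight, Category.assoc, MonoidalCategory.whiskerLeft_comp,
    Functor.LaxMonoidal.μ_natural_left_assoc, Functor.LaxMonoidal.μ_natural_right_assoc,
    ← W.map_comp, ModObj.mul_smul_self]
  simp

lemma modMap_smul_hom (W : B ⥤ C) [W.LaxMonoidal] {R : B} [MonObj R] {M N : Mod B R}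
    (f : M ⟶ N) :
    (Functor.LaxMonoidal.μ W R M.X ≫ W.map (ModObj.smul (M := R) (X := M.X))) ≫ W.map f.hom =
      W.obj R ◁ W.map f.hom ≫
        Functor.LaxMonoidal.μ W R N.X ≫ W.map (ModObj.smul (M := R) (X := N.X)) := by
  rw [Functor.LaxMonoidal.μ_natural_right_assoc, Category.assoc, ← W.map_comp, ← W.map_comp]
  congr 2
  exact modSmulHom f

/-- The functor from modules over a monoid `R` to modules over `W R` induced by a lax monoidal
functor `W`. -/
def modMap (W : B ⥤ C) [W.LaxMonoidal] (R : Mon B) : Mod B R.X ⥤ Mod C (W.mapMon.obj R).X where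
  obj M :=
    letI : ModObj (W.mapMon.obj R).X (W.obj M.X) :=
      { smul := Functor.LaxMonoidal.μ W R.X M.X ≫ W.map (ModObj.smul (M := R.X) (X := M.X))
        one_smul := modMap_one_smul W R.X M.X
        mul_smul := modMap_mul_smul W R.X M.X }
    ⟨W.obj M.X⟩
  map f := Mod.Hom.mk' (W.map f.hom) (modMap_smul_hom W f)
  map_id M := Mod.hom_ext _ _ (W.map_id M.X)
  map_comp f g := Mod.hom_ext _ _ (W.map_comp f.hom g.hom)

lemma extendScalarsToUnit_condition [HasCoequalizers C] {S : C} [MonObj S] (β : S ⟶ 𝟙_ C)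
    {M N : Mod C S} (f : M ⟶ N) :
    ModObj.smul (M := S) (X := M.X) ≫ f.hom ≫
        coequalizer.π (ModObj.smul (M := S) (X := N.X)) (β ▷ N.X ≫ (λ_ N.X).hom) =
      (β ▷ M.X ≫ (λ_ M.X).hom) ≫ f.hom ≫
        coequalizer.π (ModObj.smul (M := S) (X := N.X)) (β ▷ N.X ≫ (λ_ N.X).hom) := by
  have h : (β ▷ M.X ≫ (λ_ M.X).hom) ≫ f.hom = S ◁ f.hom ≫ β ▷ N.X ≫ (λ_ N.X).hom := by
    rw [Category.assoc, ← leftUnitor_naturality, whisker_exchange_assoc]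
  rw [← Category.assoc, modSmulHom f, Category.assoc,
    coequalizer.condition (ModObj.smul (M := S) (X := N.X)), ← Category.assoc, ← h, Category.assoc]

/-- Extension of scalars `M ↦ 𝟙 ⊗_S M` from modules over a monoid `S` to modules over the trivial
monoid `𝟙` (that is, to objects of `C`), along a homomorphism `β : S ⟶ 𝟙`: the coequaliser of the
action `S ⊗ M ⟶ M` and of `S ⊗ M ⟶ 𝟙 ⊗ M ≅ M` induced by `β`. -/
def extendScalarsToUnit [HasCoequalizers C] {S : C} [MonObj S] (β : S ⟶ 𝟙_ C) [IsMonHom β] :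
    Mod C S ⥤ C where
  obj M := coequalizer (ModObj.smul (M := S) (X := M.X)) (β ▷ M.X ≫ (λ_ M.X).hom)
  map {M N} f := coequalizer.desc
    (f.hom ≫ coequalizer.π (ModObj.smul (M := S) (X := N.X)) (β ▷ N.X ≫ (λ_ N.X).hom))
    (extendScalarsToUnit_condition β f)
  map_id M := by
    apply coequalizer.hom_ext
    simp
  map_comp f g := by
    apply coequalizer.hom_ext
    simp

end Modules

section UniversalExtension

variable {A : Type u₁} [Category.{v₁} A] [MonoidalCategory A] [SymmetricCategory A]
  {A' : Type u₂} [Category.{v₂} A'] [MonoidalCategory A'] [SymmetricCategory A']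
  {B : Type u₃} [Category.{v₃} B] [MonoidalCategory B] [SymmetricCategory B]

/-- The monoid `R = γ(f_* 𝟙)` of `B`, where `G = f_* : A' ⥤ A`. -/
def extensionMonoid (G : A' ⥤ A) [G.LaxMonoidal] (γ : A ⥤ B) [γ.Braided] : Mon B :=
  γ.mapMon.obj (G.mapMon.obj (Mon.trivial A'))

/-- The universal extension `B' = B^R`: the category of modules over `R = γ(f_* 𝟙)` in `B`. -/
abbrev UniversalExtension (G : A' ⥤ A) [G.LaxMonoidal] (γ : A ⥤ B) [γ.Braided] :=
  Mod B (extensionMonoid G γ).X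

/-- The unit object of `B'`: the monoid `R` as a module over itself. -/
def UniversalExtension.unit (G : A' ⥤ A) [G.LaxMonoidal] (γ : A ⥤ B) [γ.Braided] :
    UniversalExtension G γ :=
  Mod.regular (extensionMonoid G γ).X

/-- `B'` is connected: the ring `Z(B') = End(𝟙)` of endomorphisms of its unit object is a field. -/
def UniversalExtension.IsConnected [Preadditive B] [MonoidalPreadditive B]
    (G : A' ⥤ A) [G.LaxMonoidal] (γ : A ⥤ B) [γ.Braided] : Prop :=
  IsField (End (UniversalExtension.unit G γ))

variable {C : Type u₄} [Category.{v₄} C] [MonoidalCategory C] [SymmetricCategory C]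

section Augmentation

variable {F : A ⥤ A'} [F.Braided] {G : A' ⥤ A} [G.LaxMonoidal] (adj : F ⊣ G)
  [adj.IsMonoidal] (γ : A ⥤ B) [γ.Braided] (ωB : B ⥤ C) [ωB.Braided] (ω' : A' ⥤ C) [ω'.Braided]
  (θ : γ ⋙ ωB ≅ F ⋙ ω') [NatTrans.IsMonoidal θ.hom]

lemma extensionAugmentation_one :
    (Functor.LaxMonoidal.ε ωB ≫ ωB.map (Functor.LaxMonoidal.ε γ ≫ γ.map
      (Functor.LaxMonoidal.ε G ≫ G.map (𝟙 (𝟙_ A'))))) ≫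
      θ.hom.app (G.obj (𝟙_ A')) ≫ ω'.map (adj.counit.app (𝟙_ A')) ≫
        Functor.OplaxMonoidal.η ω' = 𝟙 (𝟙_ C) := by
  have h1 := NatTrans.IsMonoidal.unit (τ := θ.hom)
  have h2 := NatTrans.IsMonoidal.unit (τ := adj.counit)
  have h3 := θ.hom.naturality (Functor.LaxMonoidal.ε G)
  simp at h1 h2 h3 ⊢
  rw [reassoc_of% h3, reassoc_of% h1, ← ω'.map_comp_assoc, ← ω'.map_comp_assoc]
  simp [h2]

lemma extensionAugmentation_mul :
    (Functor.LaxMonoidal.μ ωB _ _ ≫ ωB.map (Functor.LaxMonoidal.μ γ _ _ ≫ γ.map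
      (Functor.LaxMonoidal.μ G (𝟙_ A') (𝟙_ A') ≫ G.map (λ_ (𝟙_ A')).hom))) ≫
      θ.hom.app (G.obj (𝟙_ A')) ≫ ω'.map (adj.counit.app (𝟙_ A')) ≫
        Functor.OplaxMonoidal.η ω' =
    ((θ.hom.app (G.obj (𝟙_ A')) ≫ ω'.map (adj.counit.app (𝟙_ A')) ≫
        Functor.OplaxMonoidal.η ω') ⊗ₘ (θ.hom.app (G.obj (𝟙_ A')) ≫
          ω'.map (adj.counit.app (𝟙_ A')) ≫ Functor.OplaxMonoidal.η ω')) ≫ (λ_ (𝟙_ C)).hom := by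
  have h1 := NatTrans.IsMonoidal.tensor (τ := θ.hom) (G.obj (𝟙_ A')) (G.obj (𝟙_ A'))
  have h2 := NatTrans.IsMonoidal.tensor (τ := adj.counit) (𝟙_ A') (𝟙_ A')
  have h3 := θ.hom.naturality (Functor.LaxMonoidal.μ G (𝟙_ A') (𝟙_ A') ≫ G.map (λ_ (𝟙_ A')).hom)
  simp at h1 h2 h3 ⊢
  rw [reassoc_of% h3, reassoc_of% h1]
  have h4 : ω'.map (Functor.LaxMonoidal.μ F (G.obj (𝟙_ A')) (G.obj (𝟙_ A'))) ≫
      ω'.map (F.map (Functor.LaxMonoidal.μ G (𝟙_ A') (𝟙_ A'))) ≫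
      ω'.map (F.map (G.map (λ_ (𝟙_ A')).hom)) ≫ ω'.map (adj.counit.app (𝟙_ A')) =
      ω'.map (adj.counit.app (𝟙_ A') ⊗ₘ adj.counit.app (𝟙_ A')) ≫ ω'.map (λ_ (𝟙_ A')).hom := by
    have := adj.counit.naturality (λ_ (𝟙_ A')).hom
    simp only [Functor.comp_obj, Functor.comp_map, Functor.id_map, Functor.id_obj] at this
    simp only [← ω'.map_comp, ← h2, Category.assoc, this]
  rw [reassoc_of% h4, ← Functor.LaxMonoidal.μ_natural_assoc]
  have h5 : Functor.LaxMonoidal.μ ω' (𝟙_ A') (𝟙_ A') ≫ ω'.map (λ_ (𝟙_ A')).hom ≫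
      Functor.OplaxMonoidal.η ω' =
      (Functor.OplaxMonoidal.η ω' ⊗ₘ Functor.OplaxMonoidal.η ω') ≫ (λ_ (𝟙_ C)).hom := by
    rw [← cancel_epi (Functor.LaxMonoidal.ε ω' ⊗ₘ Functor.LaxMonoidal.ε ω')]
    rw [tensorHom_comp_tensorHom_assoc]
    have := Functor.LaxMonoidal.left_unitality ω' (𝟙_ A')
    rw [tensorHom_def', Category.assoc, ← reassoc_of% this]
    simp
  change _ ≫ (ω'.map (adj.counit.app (𝟙_ A')) ⊗ₘ ω'.map (adj.counit.app (𝟙_ A'))) ≫ _ = _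
  rw [← tensorHom_comp_tensorHom_assoc, ← tensorHom_comp_tensorHom_assoc]
  exact congrArg (fun t => _ ≫ _ ≫ t) h5

/-- Given tensor functors `ω' : A' ⥤ C`, `ωB : B ⥤ C` and a monoidal isomorphism
`θ : ωB γ ≅ ω' f^*`, the homomorphism of monoids
`ωB(R) = ωB γ f_* 𝟙 ≅ ω' f^* f_* 𝟙 ⟶ ω' 𝟙 ≅ 𝟙` induced by the counit of `f^* ⊣ f_*`. -/
def extensionAugmentation : (ωB.mapMon.obj (extensionMonoid G γ)).X ⟶ 𝟙_ C :=
  θ.hom.app (G.obj (𝟙_ A')) ≫ ω'.map (adj.counit.app (𝟙_ A')) ≫ Functor.OplaxMonoidal.η ω'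

instance : IsMonHom (extensionAugmentation adj γ ωB ω' θ) where
  one_hom := extensionAugmentation_one adj γ ωB ω' θ
  mul_hom := extensionAugmentation_mul adj γ ωB ω' θ

end Augmentation

/-- The functor `ω'_B : B' ⥤ C` induced by `ωB` and `ω'`: the composition of the functor
`B^R ⥤ C^{ωB(R)}` induced by `ωB` and of the extension of scalars `𝟙 ⊗_{ωB(R)} -` along the
homomorphism `ωB(R) ⟶ 𝟙`. It extends `ωB`, in the sense that `ω'_B (R ⊗ X) ≅ ωB X`. -/
def extensionFunctor [HasCoequalizers C] {F : A ⥤ A'} [F.Braided] {G : A' ⥤ A} [G.LaxMonoidal]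
    (adj : F ⊣ G) [adj.IsMonoidal] (γ : A ⥤ B) [γ.Braided] (ωB : B ⥤ C) [ωB.Braided]
    (ω' : A' ⥤ C) [ω'.Braided] (θ : γ ⋙ ωB ≅ F ⋙ ω') [NatTrans.IsMonoidal θ.hom] :
    UniversalExtension G γ ⥤ C :=
  modMap ωB (extensionMonoid G γ) ⋙
    extendScalarsToUnit (extensionAugmentation adj γ ωB ω' θ)

end UniversalExtension

/-- A strong symmetric monoidal functor `W` from a `K`-linear tensor category to the category of
finite-dimensional vector spaces over an extension `L` of `K` is a fibre functor if it is
`K`-linear, exact and faithful. -/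
structure IsFibreFunctor (K : Type*) [Field K] {L : Type w} [Field L] [Algebra K L]
    {A : Type u₁} [Category.{v₁} A] [MonoidalCategory A] [SymmetricCategory A]
    [Preadditive A] [Linear K A] (W : A ⥤ FGModuleCat.{w} L) [W.Braided] : Prop where
  additive : W.Additive
  map_smul : ∀ {X Y : A} (k : K) (f : X ⟶ Y), W.map (k • f) = algebraMap K L k • W.map f
  exact_left : PreservesFiniteLimits W
  exact_right : PreservesFiniteColimits W
  faithful : W.Faithful

end

/-! Write S = ω_B(R). The Cartesian property splits S ≅ ω'(f^*f_*1) as L^Γ, with characters χ_g and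
dual idempotents e_g (`exists_extensionIdempotents`). The augmentation defining ω'_B is χ_1, so
ω'_B(M) is the direct factor e_1 ω_B(M), and ω'_B kills f exactly when e_1 f = 0.

Connected implies faithful (`hom_eq_zero_of_elementAction_eq_zero`). By rigidity the annihilator I
of f : M → N is a subobject of R, the kernel of a morphism R → N ⊗ M^∨. An ideal of L^Γ is spanned
by the e_g it contains, so I and its annihilator I' are complementary after ω_B, hence in B, because
ω_B is exact and faithful. The component z of 1 in I' gives an endomorphism of the module R, which
is zero or invertible. If it is zero, then 1 ∈ I and f = 0; if it is invertible, no e_g lies in I.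

Faithful implies connected. End(R) embeds in End(ω'_B(R)) = L, and a nonzero endomorphism is a
monomorphism of an object with finite-dimensional fibre, hence invertible.

Full on Artin objects implies connected (`isConnected_of_full`). The object f_*1 is Artin, so Hom(1,
R) comes from Hom(1, f_*1) = Hom(f^*1, 1) = K, and linear endomorphisms of R are given by elements
of Hom(1, R).

Faithful implies full when L = K. For X, Y Artin, f^*X and f^*Y are sums of 1, so a morphism φ : γX
→ γY transports to some ψ : f^*X → f^*Y. Faithfulness of ω'_B makes ψ invariant under Γ
(`translate_eq_of_map_eq`), and averaging with the trace descends it to A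
(`exists_map_eq_of_translate_eq`). -/

noncomputable section

/-! ### Elements of a monoid and their action on modules -/

section Elements

open scoped MonObj

variable {C : Type u₁} [Category.{v₁} C] [MonoidalCategory C]

/-- The endomorphism of `X` given by an endomorphism `c` of the unit object. -/
def unitScalar (c : 𝟙_ C ⟶ 𝟙_ C) (X : C) : X ⟶ X :=
  (λ_ X).inv ≫ c ▷ X ≫ (λ_ X).hom

lemma unitScalar_naturality (c : 𝟙_ C ⟶ 𝟙_ C) {X Y : C} (p : X ⟶ Y) :
    unitScalar c X ≫ p = p ≫ unitScalar c Y := by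
  simp only [unitScalar, Category.assoc, ← leftUnitor_naturality, ← whisker_exchange_assoc,
    leftUnitor_inv_naturality_assoc]

lemma unitScalar_unit (c : 𝟙_ C ⟶ 𝟙_ C) : unitScalar c (𝟙_ C) = c := by
  rw [unitScalar, unitors_equal, rightUnitor_naturality, ← unitors_equal, Iso.inv_hom_id_assoc]

lemma unitScalar_id (X : C) : unitScalar (𝟙 (𝟙_ C)) X = 𝟙 X := by
  simp [unitScalar]

lemma unitScalar_zero [Preadditive C] [MonoidalPreadditive C] (X : C) :
    unitScalar (0 : 𝟙_ C ⟶ 𝟙_ C) X = 0 := by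
  simp [unitScalar]

lemma unit_end_comm (c d : 𝟙_ C ⟶ 𝟙_ C) : c ≫ d = d ≫ c := by
  simpa only [unitScalar_unit] using unitScalar_naturality c d

variable {S : C} [MonObj S]

/-- The endomorphism of a module `X` over `S` given by the action of an element of `S`. -/
def elementAction (a : 𝟙_ C ⟶ S) (X : C) [ModObj S X] : X ⟶ X :=
  (λ_ X).inv ≫ a ▷ X ≫ ModObj.smul (M := S) (X := X)

/-- Left multiplication on `S` by an element of `S`. -/
def elementMul (a : 𝟙_ C ⟶ S) : S ⟶ S :=
  (λ_ S).inv ≫ a ▷ S ≫ μ[S]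

lemma elementAction_one (X : C) [ModObj S X] : elementAction η[S] X = 𝟙 X := by
  simp [elementAction]

lemma elementAction_comp_of_linear (a : 𝟙_ C ⟶ S) {X Y : C} [ModObj S X] (χ : S ⟶ 𝟙_ C)
    (p : X ⟶ Y) (hp : ModObj.smul (M := S) (X := X) ≫ p = χ ▷ X ≫ (λ_ X).hom ≫ p) :
    elementAction a X ≫ p = p ≫ unitScalar (a ≫ χ) Y := by
  rw [← unitScalar_naturality]
  simp [elementAction, unitScalar, hp]

lemma elementMul_comp_char (a : 𝟙_ C ⟶ S) (χ : S ⟶ 𝟙_ C) [IsMonHom χ] :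
    elementMul a ≫ χ = χ ≫ (a ≫ χ) := by
  conv_rhs => rw [← unitScalar_unit (a ≫ χ), ← unitScalar_naturality]
  have : μ[S] ≫ χ = (χ ⊗ₘ χ) ≫ (λ_ _).hom := IsMonHom.mul_hom χ
  simp [elementMul, unitScalar, this, MonoidalCategory.tensorHom_def]

lemma elementAction_mul (a b : 𝟙_ C ⟶ S) (X : C) [ModObj S X] :
    elementAction (a ≫ elementMul b) X = elementAction a X ≫ elementAction b X := by
  simp only [elementAction, elementMul, comp_whiskerRight, Category.assoc,
    ModObj.mul_smul_self]
  have h : ModObj.smul (M := S) (X := X) ≫ (λ_ X).inv ≫ b ▷ X =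
      (λ_ (S ⊗ X)).inv ≫ b ▷ (S ⊗ X) ≫ S ◁ ModObj.smul (M := S) (X := X) := by
    rw [← whisker_exchange, ← leftUnitor_inv_naturality_assoc]
  rw [reassoc_of% h]
  simp

lemma elementAction_comp_hom (a : 𝟙_ C ⟶ S) {X Y : C} [ModObj S X] [ModObj S Y] (f : X ⟶ Y)
    (hf : ModObj.smul (M := S) (X := X) ≫ f = S ◁ f ≫ ModObj.smul (M := S) (X := Y)) :
    elementAction a X ≫ f = f ≫ elementAction a Y := by
  simp only [elementAction, Category.assoc, hf, leftUnitor_inv_naturality_assoc,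
    whisker_exchange_assoc]

end Elements

/-! ### Annihilators as subobjects -/

section Annihilator

variable {B : Type u₁} [Category.{v₁} B] [MonoidalCategory B]
  {C : Type u₂} [Category.{v₂} C] [MonoidalCategory C]

/-- The morphism φ : R → N ⊗ M^∨ is the transpose of h, and the monoidal functor W carries the
duality along. The kernel of φ is then the annihilator for the pairing h, also on points that exist
only after W. -/
lemma exists_annihilator_hom [Preadditive B] [Preadditive C] [MonoidalPreadditive C]
    (W : B ⥤ C) [W.Monoidal] {R M N : B} [HasRightDual M] (h : R ⊗ M ⟶ N) :
    ∃ (Q : B) (φ : R ⟶ Q), ∀ {T : C} (a : T ⟶ W.obj R),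
      a ≫ W.map φ = 0 ↔ a ▷ W.obj M ≫ Functor.LaxMonoidal.μ W R M ≫ W.map h = 0 := by
  have e1 : h = (tensorRightHomEquiv R M (Mᘁ) N h) ▷ M ≫ (α_ _ _ _).hom ≫
      N ◁ ε_ M (Mᘁ) ≫ (ρ_ N).hom :=
    ((tensorRightHomEquiv R M (Mᘁ) N).symm_apply_apply h).symm
  refine ⟨N ⊗ Mᘁ, tensorRightHomEquiv R M (Mᘁ) N h, fun {T} a => ⟨fun h0 => ?_, fun h0 => ?_⟩⟩
  · rw [e1]
    rw [W.map_comp, ← Functor.LaxMonoidal.μ_natural_left_assoc, ← comp_whiskerRight_assoc, h0]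
    simp
  · have e2 : tensorRightHomEquiv R M (Mᘁ) N h =
      (ρ_ R).inv ≫ R ◁ η_ M (Mᘁ) ≫ (α_ _ _ _).inv ≫ h ▷ (Mᘁ) := rfl
    rw [e2]
    have e3 : a ≫ W.map ((ρ_ R).inv ≫ R ◁ η_ M (Mᘁ) ≫ (α_ _ _ _).inv) =
        (ρ_ T).inv ≫ T ◁ (Functor.LaxMonoidal.ε W ≫ W.map (η_ M (Mᘁ)) ≫
          Functor.OplaxMonoidal.δ W _ _) ≫ (α_ _ _ _).inv ≫
          (a ▷ W.obj M ≫ Functor.LaxMonoidal.μ W R M) ▷ W.obj (Mᘁ) ≫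
          Functor.LaxMonoidal.μ W _ _ := by
      simp only [Functor.map_comp, Functor.Monoidal.map_rightUnitor_inv,
        Functor.Monoidal.map_whiskerLeft, Functor.Monoidal.map_associator_inv, Category.assoc,
        Functor.Monoidal.μ_δ_assoc, comp_whiskerRight, ← associator_inv_naturality_left_assoc,
        whisker_exchange_assoc, MonoidalCategory.whiskerLeft_comp,
        rightUnitor_inv_naturality_assoc]
    have e4 : a ≫ W.map ((ρ_ R).inv ≫ R ◁ η_ M (Mᘁ) ≫ (α_ _ _ _).inv ≫ h ▷ (Mᘁ)) =
        (a ≫ W.map ((ρ_ R).inv ≫ R ◁ η_ M (Mᘁ) ≫ (α_ _ _ _).inv)) ≫ W.map (h ▷ (Mᘁ)) := by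
      simp
    rw [e4, e3]
    simp only [Category.assoc, ← Functor.LaxMonoidal.μ_natural_left]
    rw [← comp_whiskerRight_assoc, Category.assoc, h0]
    simp

end Annihilator

section Exact

variable {B : Type u₁} [Category.{v₁} B] [Abelian B]
  {C : Type u₂} [Category.{v₂} C] [Preadditive C]

lemma exists_lift_map_kernel (W : B ⥤ C) [W.PreservesZeroMorphisms] [PreservesFiniteLimits W]
    {X Y : B} (φ : X ⟶ Y) {T : C} (a : T ⟶ W.obj X) (h : a ≫ W.map φ = 0) :
    ∃ b : T ⟶ W.obj (kernel φ), b ≫ W.map (kernel.ι φ) = a := by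
  let hl := KernelFork.mapIsLimit _ (kernelIsKernel φ) W
  exact ⟨_, (KernelFork.IsLimit.lift' hl a h).2⟩

end Exact

/-! ### Endomorphisms of the regular module -/

section RegularModule

open scoped MonObj

variable {B : Type u₁} [Category.{v₁} B] [MonoidalCategory B] {R : B} [MonObj R]

/-- Right multiplication by an element of a monoid. -/
def elementRightMul (z : 𝟙_ B ⟶ R) : R ⟶ R := (ρ_ R).inv ≫ R ◁ z ≫ μ[R]

lemma mul_elementRightMul (z : 𝟙_ B ⟶ R) :
    μ[R] ≫ elementRightMul z = R ◁ elementRightMul z ≫ μ[R] := by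
  rw [elementRightMul, rightUnitor_inv_naturality_assoc, ← whisker_exchange_assoc]
  simp

lemma one_comp_elementRightMul (z : 𝟙_ B ⟶ R) : η[R] ≫ elementRightMul z = z := by
  rw [elementRightMul, rightUnitor_inv_naturality_assoc, ← whisker_exchange_assoc]
  simp [← unitors_inv_equal]

lemma eq_elementRightMul (f : R ⟶ R) (hf : μ[R] ≫ f = R ◁ f ≫ μ[R]) :
    f = elementRightMul (η[R] ≫ f) := by
  rw [elementRightMul, MonoidalCategory.whiskerLeft_comp, Category.assoc, ← hf]
  simp

/-- Right multiplication by an element of a monoid `R`, as an endomorphism of the regular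
left module. -/
def regularEnd (z : 𝟙_ B ⟶ R) : Mod.regular R ⟶ Mod.regular R :=
  Mod.Hom.mk' (M := Mod.regular R) (N := Mod.regular R) (elementRightMul (R := R) z)
    (mul_elementRightMul z)

lemma regularEnd_hom (z : 𝟙_ B ⟶ R) : (regularEnd z).hom = elementRightMul (R := R) z := rfl

/-- A linear endomorphism is determined by the image of 1, so the endomorphisms of the unit of `B'`
are controlled by Hom(1, R). -/
lemma eq_regularEnd (f : Mod.regular R ⟶ Mod.regular R) :
    f = regularEnd (show 𝟙_ B ⟶ R from η[R] ≫ f.hom) :=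
  Mod.hom_ext _ _ (eq_elementRightMul (R := R) f.hom (modSmulHom f))

end RegularModule

/-! ### Complementary ideals: connectedness forces faithfulness -/

section Core

open scoped MonObj Obj

variable {B : Type u₁} [Category.{v₁} B] [MonoidalCategory B]
  {C : Type u₂} [Category.{v₂} C] [MonoidalCategory C]

/-- The module over `W R` obtained from a module over `R` by a lax monoidal functor `W`. -/
abbrev mapModObj (W : B ⥤ C) [W.LaxMonoidal] (R X : B) [MonObj R] [ModObj R X] :
    ModObj (W.obj R) (W.obj X) :=
  { smul := Functor.LaxMonoidal.μ W R X ≫ W.map (ModObj.smul (M := R) (X := X))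
    one_smul := modMap_one_smul W R X
    mul_smul := modMap_mul_smul W R X }

attribute [local instance] mapModObj

lemma map_smul_eq (W : B ⥤ C) [W.LaxMonoidal] (R X : B) [MonObj R] [ModObj R X] :
    ModObj.smul (M := W.obj R) (X := W.obj X) =
      Functor.LaxMonoidal.μ W R X ≫ W.map (ModObj.smul (M := R) (X := X)) := rfl

lemma map_elementRightMul (W : B ⥤ C) [W.Monoidal] {R : B} [MonObj R] (z : 𝟙_ B ⟶ R) :
    W.map (elementRightMul z) = elementRightMul (Functor.LaxMonoidal.ε W ≫ W.map z) := by
  simp only [elementRightMul, Functor.obj.μ_def, Functor.map_comp, Category.assoc,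
    Functor.Monoidal.map_rightUnitor_inv, Functor.Monoidal.map_whiskerLeft,
    Functor.Monoidal.μ_δ_assoc, MonoidalCategory.whiskerLeft_comp]

lemma elementRightMul_comp_char {S : C} [MonObj S] (a : 𝟙_ C ⟶ S) (χ : S ⟶ 𝟙_ C)
    [IsMonHom χ] : elementRightMul a ≫ χ = χ ≫ a ≫ χ := by
  have : μ[S] ≫ χ = (χ ⊗ₘ χ) ≫ (λ_ _).hom := IsMonHom.mul_hom χ
  simp only [elementRightMul, Category.assoc, this, tensorHom_def', unitors_equal,
    rightUnitor_naturality]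
  rw [← rightUnitor_naturality, ← MonoidalCategory.whiskerLeft_comp_assoc,
    whisker_exchange_assoc, ← rightUnitor_inv_naturality_assoc, ← unitors_equal,
    leftUnitor_naturality, unitors_equal, Iso.inv_hom_id_assoc]

variable [Abelian B] [MonoidalPreadditive B] [RightRigidCategory B]
  [Abelian C] [MonoidalPreadditive C]

/-- The hypotheses on `χ` and `e` say that W R is the product of copies of 1 indexed by Γ; `hsep`
and `hdiv` retain from vector spaces over a field what the ideal theory of such a product needs. -/
theorem hom_eq_zero_of_elementAction_eq_zero
    (hsep : IsSeparator (𝟙_ C)) (hdiv : ∀ c : 𝟙_ C ⟶ 𝟙_ C, c ≠ 0 → IsIso c)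
    (W : B ⥤ C) [W.Monoidal] [W.Additive] [W.Faithful] [PreservesFiniteLimits W]
    [PreservesFiniteColimits W] (R : B) [MonObj R] {Γ : Type*} [Fintype Γ] [DecidableEq Γ]
    (χ : Γ → (W.obj R ⟶ 𝟙_ C)) [∀ g, IsMonHom (χ g)] (e : Γ → (𝟙_ C ⟶ W.obj R))
    (he : ∀ g h, e g ≫ χ h = if g = h then 𝟙 _ else 0)
    (hsum : ∑ g, χ g ≫ e g = 𝟙 (W.obj R))
    (hfield : ∀ r : Mod.regular R ⟶ Mod.regular R, r = 0 ∨ IsIso r)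
    {M N : Mod B R} (f : M ⟶ N) (g₁ : Γ) (hne : 𝟙 (𝟙_ C) ≠ 0)
    (hf : elementAction (e g₁) (W.obj M.X) ≫ W.map f.hom = 0) : f = 0 := by
  have ext0 {X Y : C} (p : X ⟶ Y) (h : ∀ a : 𝟙_ C ⟶ X, a ≫ p = 0) : p = 0 :=
    hsep.def _ _ fun a => by rw [h a, comp_zero]
  have expand (a : 𝟙_ C ⟶ W.obj R) : a = ∑ g, (a ≫ χ g) ≫ e g := by
    conv_lhs => rw [← Category.comp_id a, ← hsum]
    simp [Preadditive.comp_sum]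
  have extχ {X : C} (a b : X ⟶ W.obj R) (h : ∀ g, a ≫ χ g = b ≫ χ g) : a = b := by
    rw [← Category.comp_id a, ← Category.comp_id b, ← hsum]
    simp only [Preadditive.comp_sum, reassoc_of% h]
  have mulχ (a : 𝟙_ C ⟶ W.obj R) (g) : elementMul a ≫ χ g = χ g ≫ a ≫ χ g :=
    elementMul_comp_char a (χ g)
  -- the ideal of elements annihilating `f`
  obtain ⟨Q, φ, hφ⟩ := exists_annihilator_hom W (R := R)
    (ModObj.smul (M := R) (X := M.X) ≫ f.hom)
  have hI (a : 𝟙_ C ⟶ W.obj R) :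
      a ≫ W.map φ = 0 ↔ elementAction a (W.obj M.X) ≫ W.map f.hom = 0 := by
    rw [hφ, elementAction, map_smul_eq, Category.assoc, Category.assoc, Category.assoc,
      Preadditive.IsIso.comp_left_eq_zero (f := (λ_ (W.obj M.X)).inv), W.map_comp]
  have hfW : ModObj.smul (M := W.obj R) (X := W.obj M.X) ≫ W.map f.hom =
      W.obj R ◁ W.map f.hom ≫ ModObj.smul (M := W.obj R) (X := W.obj N.X) :=
    modMap_smul_hom W f
  -- The ideal I contains e_g a = χ_g(a) e_g, and χ_g(a) is invertible.
  have hIe (a : 𝟙_ C ⟶ W.obj R) (ha : a ≫ W.map φ = 0) (g) (hg : a ≫ χ g ≠ 0) :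
      e g ≫ W.map φ = 0 := by
    have h1 : a ≫ elementMul (e g) = (a ≫ χ g) ≫ e g := by
      refine extχ _ _ fun h => ?_
      simp only [Category.assoc, mulχ, he]
      split_ifs with hgh
      · rw [hgh]
      · simp
    have h2 : (a ≫ elementMul (e g)) ≫ W.map φ = 0 := by
      rw [hI, elementAction_mul, Category.assoc, elementAction_comp_hom _ _ hfW,
        ← Category.assoc, (hI a).1 ha, zero_comp]
    have := hdiv _ hg
    rwa [h1, Category.assoc, Preadditive.IsIso.comp_left_eq_zero] at h2
  -- I is the kernel of φ; the kernel of φ' is the left annihilator I' of I in R.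
  let κ := kernel.ι φ
  obtain ⟨Q', φ', hφ'⟩ := exists_annihilator_hom W (R := R) (R ◁ κ ≫ μ[R])
  -- Since W(I) is spanned by the e_g it contains, a annihilates it exactly when the coordinates of
  -- a at these g vanish.
  have hI' (a : 𝟙_ C ⟶ W.obj R) : a ≫ W.map φ' = 0 ↔
      ∀ g, e g ≫ W.map φ = 0 → a ≫ χ g = 0 := by
    have h1 : a ≫ W.map φ' = 0 ↔ W.map κ ≫ elementMul a = 0 := by
      rw [hφ', elementMul, Functor.obj.μ_def, leftUnitor_inv_naturality_assoc,
        whisker_exchange_assoc, Preadditive.IsIso.comp_left_eq_zero (f := (λ_ (W.obj (kernel φ))).inv),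
        W.map_comp,
        Functor.LaxMonoidal.μ_natural_right_assoc]
    rw [h1]
    constructor
    · intro h g hg
      obtain ⟨b, hb⟩ := exists_lift_map_kernel W φ (e g) hg
      have := congr(b ≫ $h ≫ χ g)
      rw [Category.assoc, reassoc_of% hb, mulχ, ← Category.assoc, he] at this
      simpa using this
    · intro h
      refine ext0 _ fun b => extχ _ _ fun g => ?_
      rw [Category.assoc, Category.assoc, mulχ, zero_comp]
      by_cases hg : e g ≫ W.map φ = 0
      · rw [h g hg]; simp
      · by_cases hb : (b ≫ W.map κ) ≫ χ g = 0
        · rw [Category.assoc] at hb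
          rw [reassoc_of% hb, zero_comp]
        · refine absurd (hIe (b ≫ W.map κ) ?_ g hb) hg
          rw [Category.assoc, ← W.map_comp, kernel.condition, W.map_zero, comp_zero]
  let κ' := kernel.ι φ'
  let π := cokernel.π κ
  have hπ {T : C} (a : T ⟶ W.obj R) (ha : a ≫ W.map π = 0) : a ≫ W.map φ = 0 := by
    have hk : φ = π ≫ cokernel.desc κ φ (kernel.condition φ) := by simp [π]
    rw [hk, W.map_comp, reassoc_of% ha, zero_comp]
  have hπ' {T : C} (a : T ⟶ W.obj R) (ha : a ≫ W.map φ = 0) : a ≫ W.map π = 0 := by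
    obtain ⟨b, rfl⟩ := exists_lift_map_kernel W φ a ha
    rw [Category.assoc, ← W.map_comp, cokernel.condition, W.map_zero, comp_zero]
  have hdisj (a : 𝟙_ C ⟶ W.obj R) (h1 : a ≫ W.map φ = 0) (h2 : a ≫ W.map φ' = 0) : a = 0 := by
    refine extχ _ _ fun g => ?_
    rw [zero_comp]
    by_contra h
    exact h ((hI' a).1 h2 g (hIe a h1 g h))
  -- I' → R/I is a monomorphism because I ∩ I' = 0, which may be tested after the faithful functor
  -- W.
  have : Mono (κ' ≫ π) := by
    have : Mono (W.map (κ' ≫ π)) := by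
      refine Preadditive.mono_of_cancel_zero _ fun p hp => ext0 _ fun a => ?_
      rw [← cancel_mono (W.map κ'), zero_comp]
      refine hdisj _ (hπ _ ?_) ?_
      · rw [W.map_comp] at hp
        simp [hp]
      · rw [Category.assoc, ← W.map_comp, kernel.condition, W.map_zero, comp_zero]
    exact W.mono_of_mono_map this
  -- Each e_g lies in I or in I', so I + I' = R after W.
  have : Epi (κ' ≫ π) := by
    have : Epi (W.map (κ' ≫ π)) := by
      refine Preadditive.epi_of_cancel_zero _ fun k hk => ?_
      rw [← cancel_epi (W.map π), comp_zero]
      refine ext0 _ fun a => ?_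
      rw [expand a, Preadditive.sum_comp]
      refine Finset.sum_eq_zero fun g _ => ?_
      rw [Category.assoc]
      suffices e g ≫ W.map π ≫ k = 0 by rw [this, comp_zero]
      by_cases hg : e g ≫ W.map φ = 0
      · rw [← Category.assoc, hπ' _ hg, zero_comp]
      · have hg' : e g ≫ W.map φ' = 0 := by
          refine (hI' _).2 fun h hh => ?_
          rw [he, if_neg]
          rintro rfl
          exact hg hh
        obtain ⟨b, hb⟩ := exists_lift_map_kernel W φ' (e g) hg'
        rw [W.map_comp, Category.assoc] at hk
        rw [← hb, Category.assoc, hk, comp_zero]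
    exact W.epi_of_epi_map this
  have : IsIso (κ' ≫ π) := isIso_of_mono_of_epi _
  -- z is the element of I' congruent to 1 modulo I.
  let z : 𝟙_ B ⟶ R := η[R] ≫ π ≫ CategoryTheory.inv (κ' ≫ π) ≫ κ'
  let u := Functor.LaxMonoidal.ε W ≫ W.map z
  have hu' : u ≫ W.map φ' = 0 := by
    have : z ≫ φ' = 0 := by simp [z, κ']
    rw [Category.assoc, ← W.map_comp, this, W.map_zero, comp_zero]
  have hu : (u - η[W.obj R]) ≫ W.map φ = 0 := by
    refine hπ _ ?_
    have : z ≫ π = η[R] ≫ π := by simp [z]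
    rw [Preadditive.sub_comp, Functor.obj.η_def, Category.assoc, Category.assoc,
      ← W.map_comp, this, W.map_comp, sub_self]
  rcases hfield (regularEnd z) with h | h
  · have hz0 : z = 0 := by
      rw [← one_comp_elementRightMul z, ← regularEnd_hom, h]
      exact comp_zero
    rw [show u = 0 by simp [u, hz0], zero_sub, Preadditive.neg_comp, neg_eq_zero, hI,
      elementAction_one, Category.id_comp] at hu
    exact Mod.hom_ext _ _ (W.map_injective (hu.trans (W.map_zero _ _).symm))
  · have hiso : IsIso (elementRightMul z) :=
      ⟨(CategoryTheory.inv (regularEnd z)).hom,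
        congr($(IsIso.hom_inv_id (regularEnd z)).hom), congr($(IsIso.inv_hom_id (regularEnd z)).hom)⟩
    -- As e_{g₁} lies in I, the coordinate of u at g₁ vanishes, so right multiplication by z kills
    -- e_{g₁}. This is impossible when that multiplication is invertible.
    have h0 : e g₁ ≫ W.map (elementRightMul z) = 0 := by
      refine extχ _ _ fun g => ?_
      rw [map_elementRightMul, Category.assoc, elementRightMul_comp_char, ← Category.assoc, he]
      split_ifs with hg
      · subst hg
        change 𝟙 _ ≫ u ≫ χ g₁ = _
        rw [(hI' u).1 hu' g₁ ((hI _).2 hf), comp_zero, zero_comp]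
      · simp
    have h1 : e g₁ = 0 := by
      rwa [← cancel_mono (W.map (elementRightMul z)), zero_comp]
    have h2 := he g₁ g₁
    rw [h1, zero_comp, if_pos rfl] at h2
    exact absurd h2.symm hne

end Core

/-! ### The components of `ωB γ f_* X` indexed by Γ -/

section Components

lemma tensorHom_tensorHom_whiskerRight_leftUnitor {C : Type u₁} [Category.{v₁} C]
    [MonoidalCategory C] {X X' X'' Y Y' Y'' : C} (a : X ⟶ X') (b : Y ⟶ Y') (a' : X' ⟶ X'')
    (b' : Y' ⟶ Y'') (c : X'' ⟶ 𝟙_ C) :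
    (a ⊗ₘ b) ≫ (a' ⊗ₘ b') ≫ c ▷ Y'' ≫ (λ_ Y'').hom =
      a ▷ Y ≫ a' ▷ Y ≫ c ▷ Y ≫ (λ_ Y).hom ≫ b ≫ b' := by
  simp only [← leftUnitor_naturality, MonoidalCategory.whiskerLeft_comp,
    MonoidalCategory.tensorHom_def, Category.assoc, whisker_exchange_assoc]

variable {A : Type u₁} [Category.{v₁} A] [MonoidalCategory A] [SymmetricCategory A]
  {A' : Type u₂} [Category.{v₂} A'] [MonoidalCategory A'] [SymmetricCategory A']
  {B : Type u₃} [Category.{v₃} B] [MonoidalCategory B] [SymmetricCategory B]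
  {C : Type u₄} [Category.{v₄} C] [MonoidalCategory C] [SymmetricCategory C]

/-- The module `γ(f_* X)` over `R = γ(f_* 𝟙)`, for an object `X` of `A'`. -/
def pushforwardModule (G : A' ⥤ A) [G.LaxMonoidal] (γ : A ⥤ B) [γ.Braided] (X : A') :
    UniversalExtension G γ :=
  (modMap γ (G.mapMon.obj (Mon.trivial A'))).obj
    ((modMap G (Mon.trivial A')).obj (⟨X⟩ : Mod A' (𝟙_ A')))

section

variable {F : A ⥤ A'} [F.Braided] {G : A' ⥤ A} [G.LaxMonoidal] (adj : F ⊣ G)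
  [adj.IsMonoidal] (γ : A ⥤ B) [γ.Braided] (ωB : B ⥤ C) [ωB.Braided] (ω' : A' ⥤ C) [ω'.Braided]
  (θ : γ ⋙ ωB ≅ F ⋙ ω') [NatTrans.IsMonoidal θ.hom]

/-- The morphism `ωB γ f_* X ≅ ω' f^* f_* X ⟶ ω' X` induced by the counit of `f^* ⊣ f_*`. -/
def pushforwardComponent (X : A') : ωB.obj (γ.obj (G.obj X)) ⟶ ω'.obj X :=
  θ.hom.app (G.obj X) ≫ ω'.map (adj.counit.app X)

omit [F.Braided] [adj.IsMonoidal] [NatTrans.IsMonoidal θ.hom] in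
lemma pushforwardComponent_unit :
    pushforwardComponent adj γ ωB ω' θ (𝟙_ A') ≫ Functor.OplaxMonoidal.η ω' =
      extensionAugmentation adj γ ωB ω' θ :=
  Category.assoc _ _ _

omit [MonoidalCategory A] [SymmetricCategory A] [MonoidalCategory A'] [SymmetricCategory A']
  [MonoidalCategory B] [SymmetricCategory B] [MonoidalCategory C] [SymmetricCategory C]
  [F.Braided] [G.LaxMonoidal] [adj.IsMonoidal] [γ.Braided] [ωB.Braided] [ω'.Braided]
  [NatTrans.IsMonoidal θ.hom] in
lemma map_comp_pushforwardComponent {X : A} {Y : A'} (u : X ⟶ G.obj Y) :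
    ωB.map (γ.map u) ≫ pushforwardComponent adj γ ωB ω' θ Y =
      θ.hom.app X ≫ ω'.map (F.map u ≫ adj.counit.app Y) := by
  have := θ.hom.naturality u
  simp only [Functor.comp_obj, Functor.comp_map] at this
  rw [pushforwardComponent, reassoc_of% this, ω'.map_comp]

/-- As θ and the counit are monoidal, the component is linear along the augmentation, through which
ω_B(R) acts on the target. -/
lemma smul_pushforwardComponent (X : A') :
    ModObj.smul (M := (ωB.mapMon.obj (extensionMonoid G γ)).X)
        (X := ((modMap ωB (extensionMonoid G γ)).obj (pushforwardModule G γ X)).X) ≫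
      pushforwardComponent adj γ ωB ω' θ X =
    extensionAugmentation adj γ ωB ω' θ ▷ ωB.obj (γ.obj (G.obj X)) ≫ (λ_ _).hom ≫
      pushforwardComponent adj γ ωB ω' θ X := by
  change (Functor.LaxMonoidal.μ ωB _ _ ≫ ωB.map (Functor.LaxMonoidal.μ γ _ _ ≫ γ.map
      (Functor.LaxMonoidal.μ G (𝟙_ A') X ≫ G.map (λ_ X).hom))) ≫
      θ.hom.app (G.obj X) ≫ ω'.map (adj.counit.app X) =
    (θ.hom.app (G.obj (𝟙_ A')) ≫ ω'.map (adj.counit.app (𝟙_ A')) ≫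
      Functor.OplaxMonoidal.η ω') ▷ ωB.obj (γ.obj (G.obj X)) ≫ (λ_ _).hom ≫
      θ.hom.app (G.obj X) ≫ ω'.map (adj.counit.app X)
  have h1 := NatTrans.IsMonoidal.tensor (τ := θ.hom) (G.obj (𝟙_ A')) (G.obj X)
  have h2 := NatTrans.IsMonoidal.tensor (τ := adj.counit) (𝟙_ A') X
  have h3 := θ.hom.naturality (Functor.LaxMonoidal.μ G (𝟙_ A') X ≫ G.map (λ_ X).hom)
  simp at h1 h2 h3
  simp only [Functor.map_comp, Category.assoc, comp_whiskerRight]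
  rw [reassoc_of% h3, reassoc_of% h1]
  have h4 : ω'.map (Functor.LaxMonoidal.μ F (G.obj (𝟙_ A')) (G.obj X)) ≫
      ω'.map (F.map (Functor.LaxMonoidal.μ G (𝟙_ A') X)) ≫
      ω'.map (F.map (G.map (λ_ X).hom)) ≫ ω'.map (adj.counit.app X) =
      ω'.map (adj.counit.app (𝟙_ A') ⊗ₘ adj.counit.app X) ≫ ω'.map (λ_ X).hom := by
    have := adj.counit.naturality (λ_ X).hom
    simp only [Functor.comp_obj, Functor.comp_map, Functor.id_map, Functor.id_obj] at this
    simp only [← ω'.map_comp, ← h2, Category.assoc, this]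
  rw [h4, ← Functor.LaxMonoidal.μ_natural_assoc]
  have h5 : Functor.LaxMonoidal.μ ω' (𝟙_ A') X ≫ ω'.map (λ_ X).hom =
      Functor.OplaxMonoidal.η ω' ▷ ω'.obj X ≫ (λ_ _).hom := by
    simp
  change _ ≫ (ω'.map (adj.counit.app (𝟙_ A')) ⊗ₘ ω'.map (adj.counit.app X)) ≫ _ = _
  refine (congrArg (fun t => _ ≫ _ ≫ t) h5).trans ?_
  exact tensorHom_tensorHom_whiskerRight_leftUnitor (θ.hom.app (G.obj (𝟙_ A')))
    (θ.hom.app (G.obj X)) (ω'.map (adj.counit.app (𝟙_ A'))) (ω'.map (adj.counit.app X)) _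

end

variable {Γ : Type*} [Group Γ] {ρ : TensorPseudoAction Γ A'}
  {F : A ⥤ A'} [F.Braided] (i : TensorEquivariance ρ F) {G : A' ⥤ A} [G.LaxMonoidal] (adj : F ⊣ G)
  [adj.IsMonoidal] (γ : A ⥤ B) [γ.Braided] (ωB : B ⥤ C) [ωB.Braided] (ω' : A' ⥤ C) [ω'.Braided]
  (θ : γ ⋙ ωB ≅ F ⋙ ω') [NatTrans.IsMonoidal θ.hom]

/-- The isomorphism `ωB γ ≅ ω' f^* ≅ ω' g^* f^*`. -/
def translateComparison (g : Γ) : γ ⋙ ωB ≅ F ⋙ (ρ.pull g ⋙ ω') :=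
  θ ≪≫ Functor.isoWhiskerRight (i.iso g).symm ω' ≪≫ Functor.associator _ _ _

omit [MonoidalCategory B] [SymmetricCategory B] [MonoidalCategory C] [SymmetricCategory C]
  [γ.Braided] [ωB.Braided] [ω'.Braided] [NatTrans.IsMonoidal θ.hom] in
lemma translateComparison_hom_app (g : Γ) (X : A) :
    (translateComparison i γ ωB ω' θ g).hom.app X =
      θ.hom.app X ≫ ω'.map ((i.iso g).inv.app X) := by
  simp [translateComparison]

instance (g : Γ) : NatTrans.IsMonoidal (translateComparison i γ ωB ω' θ g).hom := by
  have := i.iso_monoidal g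
  have : NatTrans.IsMonoidal (i.iso g).inv := inferInstance
  have h : NatTrans.IsMonoidal (Functor.whiskerRight (i.iso g).inv ω') := inferInstance
  have : NatTrans.IsMonoidal (Functor.associator F (ρ.pull g) ω').hom := inferInstance
  change NatTrans.IsMonoidal (θ.hom ≫ Functor.whiskerRight (i.iso g).inv ω' ≫
    (Functor.associator F (ρ.pull g) ω').hom)
  infer_instance

-- Twisting (ω', θ) by g turns the counit component into the component of index g of the Cartesian
-- isomorphism. Every statement about the augmentation therefore applies to each factor.
omit [G.LaxMonoidal] [adj.IsMonoidal] in
lemma translate_pushforwardComponent (g : Γ) (X : A') :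
    pushforwardComponent adj γ ωB (ρ.pull g ⋙ ω') (translateComparison i γ ωB ω' θ g) X =
      θ.hom.app (G.obj X) ≫ ω'.map (i.baseChangeComponent adj X g) := by
  simp [pushforwardComponent, translateComparison_hom_app, TensorEquivariance.baseChangeComponent]

/-- The functor ω' preserves the product decomposition of f^*f_*X, so the components exhibit ω_B γ
f_* X as a product over Γ. -/
lemma exists_unique_pushforwardComponents [Finite Γ] [HasFiniteProducts A']
    (hcart : i.IsCartesian adj) [PreservesFiniteLimits ω'] (X : A') {T : C}
    (t : ∀ g : Γ, T ⟶ ω'.obj ((ρ.pull g).obj X)) :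
    ∃! s : T ⟶ ωB.obj (γ.obj (G.obj X)), ∀ g : Γ,
      s ≫ pushforwardComponent adj γ ωB (ρ.pull g ⋙ ω') (translateComparison i γ ωB ω' θ g) X =
        t g := by
  let c : Fan fun g : Γ => (ρ.pull g).obj X :=
    Fan.mk (F.obj (G.obj X)) fun g => i.baseChangeComponent adj X g
  have : IsIso ((productIsProduct fun g : Γ => (ρ.pull g).obj X).lift c) := by
    have h : (productIsProduct fun g : Γ => (ρ.pull g).obj X).lift c =
        Pi.lift fun g => i.baseChangeComponent adj X g :=
      limit.hom_ext fun ⟨g⟩ =>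
        ((productIsProduct fun g : Γ => (ρ.pull g).obj X).fac c ⟨g⟩).trans
          (limit.lift_π _ _).symm
    rw [h]
    exact hcart X
  have hc : IsLimit c := IsLimit.ofPointIso (productIsProduct fun g : Γ => (ρ.pull g).obj X)
  have hc' := isLimitFanMkObjOfIsLimit ω' _ _ hc
  refine ⟨Fan.IsLimit.lift hc' t ≫ θ.inv.app (G.obj X), fun g => ?_, fun s hs => ?_⟩
  · rw [translate_pushforwardComponent, Category.assoc, Iso.inv_hom_id_app_assoc]
    exact Fan.IsLimit.fac hc' t g
  · rw [← Iso.app_inv, Iso.eq_comp_inv]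
    refine Fan.IsLimit.hom_ext hc' _ _ fun g => ?_
    have h := hs g
    rw [translate_pushforwardComponent, ← Category.assoc] at h
    exact h.trans (Fan.IsLimit.fac hc' t g).symm

lemma translate_one_pushforwardComponent (X : A') :
    pushforwardComponent adj γ ωB (ρ.pull 1 ⋙ ω') (translateComparison i γ ωB ω' θ 1) X =
      pushforwardComponent adj γ ωB ω' θ X ≫ ω'.map (ρ.unit.hom.app X) := by
  have h : (i.iso 1).inv.app (G.obj X) = ρ.unit.hom.app (F.obj (G.obj X)) := by
    rw [← cancel_mono ((i.iso 1).hom.app (G.obj X)), i.iso_one]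
    simp
  rw [translate_pushforwardComponent, TensorEquivariance.baseChangeComponent, h,
    ← ρ.unit.hom.naturality]
  simp [pushforwardComponent]

/-- The isomorphism between the identity and 1^* is monoidal; hence the augmentation is the factor
of index 1. -/
lemma translate_one_extensionAugmentation :
    extensionAugmentation adj γ ωB (ρ.pull 1 ⋙ ω') (translateComparison i γ ωB ω' θ 1) =
      extensionAugmentation adj γ ωB ω' θ := by
  rw [← pushforwardComponent_unit, ← pushforwardComponent_unit, translate_one_pushforwardComponent,
    Category.assoc]
  congr 1
  have := ρ.unit_monoidal
  have h := NatTrans.IsMonoidal.unit (τ := ρ.unit.hom)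
  rw [← cancel_epi (Functor.LaxMonoidal.ε ω')]
  have h2 : Functor.LaxMonoidal.ε ω' ≫ ω'.map (ρ.unit.hom.app (𝟙_ A')) =
    Functor.LaxMonoidal.ε (ρ.pull 1 ⋙ ω') := by
      simp at h
      simp [h]
  rw [reassoc_of% h2]
  simp
end Components

/-! ### Finite-dimensional vector spaces -/

section VectorSpaces

variable {L : Type w} [Field L]

/-- The element of the finite-dimensional vector space `X` as a morphism from the unit object. -/
def FGModuleCat.homOfElement (X : FGModuleCat.{w} L) (x : X) : 𝟙_ (FGModuleCat.{w} L) ⟶ X :=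
  InducedCategory.homMk (ModuleCat.ofHom (LinearMap.toSpanSingleton L X x))

lemma FGModuleCat.isSeparator_unit : IsSeparator (𝟙_ (FGModuleCat.{w} L)) := by
  rw [isSeparator_def]
  intro X Y f g h
  apply FGModuleCat.hom_ext
  refine LinearMap.ext fun x => ?_
  have h1 := h (FGModuleCat.homOfElement X x)
  have h2 : ∀ k : X ⟶ Y, (FGModuleCat.homOfElement X x ≫ k).hom.hom (1 : L) = k.hom.hom x := by
    intro k
    change k.hom.hom (LinearMap.toSpanSingleton L X x 1) = _
    simp
  rw [← h2 f, h1, h2]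

lemma FGModuleCat.unit_end_eq_smul (c : 𝟙_ (FGModuleCat.{w} L) ⟶ 𝟙_ (FGModuleCat.{w} L)) :
    ∃ k : L, c = k • 𝟙 _ := by
  refine ⟨c.hom.hom (1 : L), ?_⟩
  apply FGModuleCat.hom_ext
  refine LinearMap.ext fun x => ?_
  change c.hom.hom x = (c.hom.hom (1 : L) : L) * (x : L)
  have : c.hom.hom ((x : L) • (1 : L)) = (x : L) • c.hom.hom (1 : L) := map_smul _ _ _
  rw [smul_eq_mul, mul_one] at this
  rw [this, mul_comm]
  rfl

lemma FGModuleCat.unit_id_ne_zero : 𝟙 (𝟙_ (FGModuleCat.{w} L)) ≠ 0 := by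
  intro h
  have : (1 : L) = 0 := congr(($h).hom.hom (1 : L))
  exact one_ne_zero this

lemma FGModuleCat.unit_end_isIso (c : 𝟙_ (FGModuleCat.{w} L) ⟶ 𝟙_ (FGModuleCat.{w} L))
    (hc : c ≠ 0) : IsIso c := by
  obtain ⟨k, rfl⟩ := FGModuleCat.unit_end_eq_smul c
  have hk : k ≠ 0 := by
    rintro rfl
    simp at hc
  exact ⟨k⁻¹ • 𝟙 _, by simp [hk, smul_smul], by simp [hk, smul_smul]⟩

lemma FGModuleCat.isIso_of_mono_end {X : FGModuleCat.{w} L} (f : X ⟶ X) [Mono f] : IsIso f := by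
  have h1 : Mono ((forget₂ (FGModuleCat.{w} L) (ModuleCat.{w} L)).map f) := inferInstance
  have h2 : Function.Injective f.hom.hom := (ModuleCat.mono_iff_injective _).1 h1
  have h3 : Function.Surjective f.hom.hom := LinearMap.injective_iff_surjective.1 h2
  have h4 : Epi ((forget₂ (FGModuleCat.{w} L) (ModuleCat.{w} L)).map f) :=
    (ModuleCat.epi_iff_surjective _).2 h3
  have : Epi f := (forget₂ (FGModuleCat.{w} L) (ModuleCat.{w} L)).epi_of_epi_map h4
  exact isIso_of_mono_of_epi f

end VectorSpaces

/-! ### Free modules, and fields of endomorphisms -/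

section FreeModule

open scoped MonObj

variable {B : Type u₁} [Category.{v₁} B] [MonoidalCategory B] (R : B) [MonObj R]

/-- The free module `R ⊗ X`. -/
def freeModule (X : B) : Mod B R :=
  letI : ModObj R (R ⊗ X) :=
    { smul := (α_ R R X).inv ≫ μ[R] ▷ X
      one_smul := by
        change η[R] ▷ (R ⊗ X) ≫ (α_ R R X).inv ≫ μ[R] ▷ X = (λ_ (R ⊗ X)).hom
        rw [associator_inv_naturality_left_assoc, ← comp_whiskerRight, MonObj.one_mul]
        simp
      mul_smul := by
        change μ[R] ▷ (R ⊗ X) ≫ (α_ R R X).inv ≫ μ[R] ▷ X = (α_ R R (R ⊗ X)).hom ≫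
          R ◁ ((α_ R R X).inv ≫ μ[R] ▷ X) ≫ (α_ R R X).inv ≫ μ[R] ▷ X
        rw [associator_inv_naturality_left_assoc, ← comp_whiskerRight, MonObj.mul_assoc]
        simp }
  ⟨R ⊗ X⟩

variable {R}

/-- The morphism of modules `R ⊗ X ⟶ M` extending a morphism `X ⟶ M`. -/
def freeModuleDesc {X : B} (M : Mod B R) (u : X ⟶ M.X) : freeModule R X ⟶ M :=
  Mod.Hom.mk' (M := freeModule R X) (R ◁ u ≫ ModObj.smul (M := R) (X := M.X)) (by
    change ((α_ R R X).inv ≫ μ[R] ▷ X) ≫ R ◁ u ≫ ModObj.smul (M := R) (X := M.X) =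
      R ◁ (R ◁ u ≫ ModObj.smul (M := R) (X := M.X)) ≫ ModObj.smul (M := R) (X := M.X)
    rw [Category.assoc, ← whisker_exchange_assoc, ModObj.mul_smul_self]
    simp)

lemma freeModuleDesc_hom {X : B} (M : Mod B R) (u : X ⟶ M.X) :
    (freeModuleDesc M u).hom = R ◁ u ≫ ModObj.smul (M := R) (X := M.X) := rfl

lemma unit_freeModuleDesc {X : B} (M : Mod B R) (u : X ⟶ M.X) :
    (λ_ X).inv ≫ η[R] ▷ X ≫ R ◁ u ≫ ModObj.smul (M := R) (X := M.X) = u := by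
  rw [← whisker_exchange_assoc, ModObj.one_smul_self]
  simp

lemma freeModuleDesc_injective {X : B} (M : Mod B R) :
    Function.Injective (freeModuleDesc (X := X) M) := fun u v h => by
  rw [← unit_freeModuleDesc M u, ← unit_freeModuleDesc M v, ← freeModuleDesc_hom,
    ← freeModuleDesc_hom, h]

lemma freeModuleDesc_comp {X : B} {M N : Mod B R} (u : X ⟶ M.X) (f : M ⟶ N) :
    freeModuleDesc M u ≫ f = freeModuleDesc N (u ≫ f.hom) := by
  refine Mod.hom_ext _ _ ?_
  change (R ◁ u ≫ ModObj.smul (M := R) (X := M.X)) ≫ f.hom = _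
  rw [Category.assoc, modSmulHom, freeModuleDesc_hom, MonoidalCategory.whiskerLeft_comp_assoc]

/-- Monomorphisms are tested on free modules: forgetting the action is right adjoint to R ⊗ -. -/
lemma mono_hom_of_mono {M N : Mod B R} (f : M ⟶ N) [Mono f] : Mono f.hom :=
  ⟨fun u v h => freeModuleDesc_injective M <| by
    rw [← cancel_mono f, freeModuleDesc_comp, freeModuleDesc_comp, h]⟩

lemma isIso_of_isIso_hom {M N : Mod B R} (f : M ⟶ N) [IsIso f.hom] : IsIso f := by
  refine ⟨Mod.Hom.mk' (inv f.hom) ?_, Mod.hom_ext _ _ (IsIso.hom_inv_id f.hom),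
    Mod.hom_ext _ _ (IsIso.inv_hom_id f.hom)⟩
  change ModObj.smul (M := R) (X := N.X) ≫ inv f.hom =
    R ◁ inv f.hom ≫ ModObj.smul (M := R) (X := M.X)
  rw [IsIso.comp_inv_eq, Category.assoc, modSmulHom, ← MonoidalCategory.whiskerLeft_comp_assoc]
  simp

end FreeModule

section RegularField

variable {B : Type u₁} [Category.{v₁} B] [Preadditive B]

lemma isField_end_iff (X : B) : IsField (End X) ↔
    𝟙 X ≠ 0 ∧ (∀ r s : X ⟶ X, r ≫ s = s ≫ r) ∧ ∀ r : X ⟶ X, r = 0 ∨ IsIso r := by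
  constructor
  · intro h
    refine ⟨fun h0 => ?_, fun r s => h.mul_comm (show End X from s) r, fun r => ?_⟩
    · obtain ⟨x, y, hxy⟩ := h.exists_pair_ne
      refine hxy ?_
      rw [← Category.comp_id (show X ⟶ X from x), ← Category.comp_id (show X ⟶ X from y), h0,
        comp_zero, comp_zero]
    · rw [or_iff_not_imp_left]
      intro hr
      obtain ⟨s, hs⟩ := h.mul_inv_cancel (a := (show End X from r)) hr
      exact ⟨s, (h.mul_comm _ _).trans hs, hs⟩
  · rintro ⟨h1, h2, h3⟩
    refine ⟨⟨𝟙 X, 0, h1⟩, fun r s => h2 s r, fun {r} hr => ?_⟩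
    have := (h3 r).resolve_left hr
    exact ⟨(inv (show X ⟶ X from r) : X ⟶ X), IsIso.inv_hom_id (show X ⟶ X from r)⟩

end RegularField

/-! ### Extension of scalars along a character -/

section ExtendScalars

open scoped MonObj

variable {C : Type u₁} [Category.{v₁} C] [MonoidalCategory C] [HasCoequalizers C] {S : C}
  [MonObj S] (β : S ⟶ 𝟙_ C) [IsMonHom β]

/-- The projection `M ⟶ 𝟙 ⊗_S M`. -/
def extendScalarsProj (M : Mod C S) : M.X ⟶ (extendScalarsToUnit β).obj M :=
  coequalizer.π _ _

instance (M : Mod C S) : Epi (extendScalarsProj β M) :=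
  inferInstanceAs (Epi (coequalizer.π _ _))

lemma smul_extendScalarsProj (M : Mod C S) :
    ModObj.smul (M := S) (X := M.X) ≫ extendScalarsProj β M =
      β ▷ M.X ≫ (λ_ M.X).hom ≫ extendScalarsProj β M :=
  (coequalizer.condition _ _).trans (Category.assoc _ _ _)

lemma extendScalarsProj_naturality {M N : Mod C S} (f : M ⟶ N) :
    extendScalarsProj β M ≫ (extendScalarsToUnit β).map f = f.hom ≫ extendScalarsProj β N :=
  coequalizer.π_desc _ _

lemma exists_extendScalarsProj_comp (M : Mod C S) {X : C} (p : M.X ⟶ X)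
    (hp : ModObj.smul (M := S) (X := M.X) ≫ p = β ▷ M.X ≫ (λ_ M.X).hom ≫ p) :
    ∃ q : (extendScalarsToUnit β).obj M ⟶ X, extendScalarsProj β M ≫ q = p :=
  ⟨coequalizer.desc p (hp.trans (Category.assoc _ _ _).symm), coequalizer.π_desc _ _⟩

lemma elementAction_extendScalarsProj (M : Mod C S) (a : 𝟙_ C ⟶ S) :
    elementAction a M.X ≫ extendScalarsProj β M =
      extendScalarsProj β M ≫ unitScalar (a ≫ β) _ :=
  elementAction_comp_of_linear a β _ (smul_extendScalarsProj β M)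

/-- The map induced by β and the class of the unit of S are inverse to each other. -/
lemma nonempty_extendScalars_iso_unit (M : Mod C S) (e : M.X ≅ S)
    (he : ModObj.smul (M := S) (X := M.X) ≫ e.hom = S ◁ e.hom ≫ μ[S]) :
    Nonempty ((extendScalarsToUnit β).obj M ≅ 𝟙_ C) := by
  have hβ : μ[S] ≫ β = (β ⊗ₘ β) ≫ (λ_ _).hom := IsMonHom.mul_hom β
  have hβ1 : η[S] ≫ β = 𝟙 _ := IsMonHom.one_hom β
  obtain ⟨q, hq⟩ := exists_extendScalarsProj_comp β M (e.hom ≫ β) (by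
    rw [reassoc_of% he, hβ, MonoidalCategory.tensorHom_def, Category.assoc,
      whisker_exchange_assoc, leftUnitor_naturality, leftUnitor_naturality_assoc])
  have ht : μ[S] ≫ e.inv ≫ extendScalarsProj β M =
      β ▷ S ≫ (λ_ S).hom ≫ e.inv ≫ extendScalarsProj β M := by
    have h1 : μ[S] ≫ e.inv = S ◁ e.inv ≫ ModObj.smul (M := S) (X := M.X) := by
      rw [Iso.comp_inv_eq, Category.assoc, he]
      simp
    rw [reassoc_of% h1, smul_extendScalarsProj, whisker_exchange_assoc,
      leftUnitor_naturality_assoc]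
  -- In 1 ⊗_S S one has x = x · 1 = β(x) · 1.
  have ht' : e.inv ≫ extendScalarsProj β M = β ≫ η[S] ≫ e.inv ≫ extendScalarsProj β M := by
    have h1 : (ρ_ S).inv ≫ S ◁ η[S] ≫ μ[S] = 𝟙 S := by simp
    conv_lhs => rw [← Category.id_comp (e.inv ≫ _), ← h1]
    simp only [Category.assoc]
    rw [ht, whisker_exchange_assoc, ← rightUnitor_inv_naturality_assoc,
      leftUnitor_naturality_assoc, ← unitors_inv_equal, Iso.inv_hom_id_assoc]
  refine ⟨⟨q, η[S] ≫ e.inv ≫ extendScalarsProj β M, ?_, ?_⟩⟩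
  · rw [← cancel_epi (extendScalarsProj β M), reassoc_of% hq, ← ht']
    simp
  · simp [hq, hβ1]

end ExtendScalars

section Elements

open scoped MonObj

/-- This is a(sx) = (as)x = χ(s) ax. Consequently the action of a factors through extension of
scalars along χ. -/
lemma smul_elementAction {C : Type u₁} [Category.{v₁} C] [MonoidalCategory C] {S : C} [MonObj S]
    (a : 𝟙_ C ⟶ S) (χ : S ⟶ 𝟙_ C) (h : elementMul a = χ ≫ a) (X : C) [ModObj S X] :
    ModObj.smul (M := S) (X := X) ≫ elementAction a X =
      χ ▷ X ≫ (λ_ X).hom ≫ elementAction a X := by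
  have h1 : ModObj.smul (M := S) (X := X) ≫ (λ_ X).inv ≫ a ▷ X =
      (λ_ (S ⊗ X)).inv ≫ a ▷ (S ⊗ X) ≫ S ◁ ModObj.smul (M := S) (X := X) := by
    rw [← whisker_exchange, ← leftUnitor_inv_naturality_assoc]
  have h2 := congr($h ▷ X ≫ ModObj.smul (M := S) (X := X))
  simp only [elementMul, comp_whiskerRight, Category.assoc, ModObj.mul_smul_self] at h2
  simp only [elementAction, reassoc_of% h1, Iso.hom_inv_id_assoc, ← h2]
  simp

end Elements

/-! ### The functor `ω'_B` and the idempotents of `ωB R` -/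

section ExtensionFunctor

variable {A : Type u₁} [Category.{v₁} A] [MonoidalCategory A] [SymmetricCategory A]
  {A' : Type u₂} [Category.{v₂} A'] [MonoidalCategory A'] [SymmetricCategory A']
  {B : Type u₃} [Category.{v₃} B] [MonoidalCategory B] [SymmetricCategory B]
  {C : Type u₄} [Category.{v₄} C] [MonoidalCategory C] [SymmetricCategory C]
  {F : A ⥤ A'} [F.Braided] {G : A' ⥤ A} [G.LaxMonoidal] (adj : F ⊣ G)
  [adj.IsMonoidal] (γ : A ⥤ B) [γ.Braided] (ωB : B ⥤ C) [ωB.Braided] (ω' : A' ⥤ C) [ω'.Braided]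
  (θ : γ ⋙ ωB ≅ F ⋙ ω') [NatTrans.IsMonoidal θ.hom]

/-- The module `ωB M` over the monoid `ωB R`. -/
abbrev fibreModule (M : UniversalExtension G γ) : Mod C (ωB.mapMon.obj (extensionMonoid G γ)).X :=
  (modMap ωB (extensionMonoid G γ)).obj M

section

variable [HasCoequalizers C]

/-- The projection `ωB M ⟶ 𝟙 ⊗_{ωB R} ωB M`. -/
def extensionProj (M : UniversalExtension G γ) :
    ωB.obj M.X ⟶ (extensionFunctor adj γ ωB ω' θ).obj M :=
  extendScalarsProj (extensionAugmentation adj γ ωB ω' θ) (fibreModule γ ωB M)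

instance (M : UniversalExtension G γ) : Epi (extensionProj adj γ ωB ω' θ M) :=
  inferInstanceAs (Epi (extendScalarsProj (extensionAugmentation adj γ ωB ω' θ)
    (fibreModule γ ωB M)))

lemma extensionProj_naturality {M N : UniversalExtension G γ} (f : M ⟶ N) :
    extensionProj adj γ ωB ω' θ M ≫ (extensionFunctor adj γ ωB ω' θ).map f =
      ωB.map f.hom ≫ extensionProj adj γ ωB ω' θ N :=
  extendScalarsProj_naturality (extensionAugmentation adj γ ωB ω' θ)
    ((modMap ωB (extensionMonoid G γ)).map f)

lemma extensionFunctor_map_eq_iff {M N : UniversalExtension G γ} (f g : M ⟶ N) :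
    (extensionFunctor adj γ ωB ω' θ).map f = (extensionFunctor adj γ ωB ω' θ).map g ↔
      ωB.map f.hom ≫ extensionProj adj γ ωB ω' θ N =
        ωB.map g.hom ≫ extensionProj adj γ ωB ω' θ N := by
  rw [← cancel_epi (extensionProj adj γ ωB ω' θ M), extensionProj_naturality,
    extensionProj_naturality]

lemma nonempty_extensionFunctor_unit_iso :
    Nonempty ((extensionFunctor adj γ ωB ω' θ).obj (UniversalExtension.unit G γ) ≅ 𝟙_ C) :=
  nonempty_extendScalars_iso_unit (extensionAugmentation adj γ ωB ω' θ)
    (fibreModule γ ωB (UniversalExtension.unit G γ)) (Iso.refl _) (by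
      refine (Category.comp_id _).trans ?_
      refine Eq.trans ?_ (congrArg (fun t => t ≫ _) (MonoidalCategory.whiskerLeft_id _ _).symm)
      exact (Category.id_comp _).symm)

end

variable {Γ : Type*} [Group Γ] {ρ : TensorPseudoAction Γ A'} (i : TensorEquivariance ρ F)

/-- The homomorphism `ωB R ⟶ 𝟙` corresponding to the factor with index `g` of `f^* f_* 𝟙`. -/
def extensionCharacter (g : Γ) : ωB.obj (γ.obj (G.obj (𝟙_ A'))) ⟶ 𝟙_ C :=
  extensionAugmentation adj γ ωB (ρ.pull g ⋙ ω') (translateComparison i γ ωB ω' θ g)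

lemma extensionCharacter_eq (g : Γ) :
    extensionCharacter adj γ ωB ω' θ i g =
      pushforwardComponent adj γ ωB (ρ.pull g ⋙ ω') (translateComparison i γ ωB ω' θ g) (𝟙_ A') ≫
        Functor.OplaxMonoidal.η (ρ.pull g ⋙ ω') :=
  (pushforwardComponent_unit _ _ _ _ _).symm

lemma extensionCharacter_one :
    extensionCharacter adj γ ωB ω' θ i 1 = extensionAugmentation adj γ ωB ω' θ :=
  translate_one_extensionAugmentation i adj γ ωB ω' θ

instance extensionCharacter_isMonHom (g : Γ) : IsMonHom (M := (ωB.mapMon.obj (extensionMonoid G γ)).X) (N := 𝟙_ C)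
    (extensionCharacter adj γ ωB ω' θ i g) :=
  inferInstanceAs (IsMonHom (extensionAugmentation adj γ ωB (ρ.pull g ⋙ ω')
    (translateComparison i γ ωB ω' θ g)))

/-- The multiplication by an element of `ωB R` on `ωB R`. -/
def fibreMul (a : 𝟙_ C ⟶ ωB.obj (γ.obj (G.obj (𝟙_ A')))) :
    ωB.obj (γ.obj (G.obj (𝟙_ A'))) ⟶ ωB.obj (γ.obj (G.obj (𝟙_ A'))) :=
  elementMul (S := (ωB.mapMon.obj (extensionMonoid G γ)).X) a

/-- The action of an element of `ωB R` on `ωB M`. -/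
def fibreAction (a : 𝟙_ C ⟶ ωB.obj (γ.obj (G.obj (𝟙_ A')))) (M : UniversalExtension G γ) :
    ωB.obj M.X ⟶ ωB.obj M.X :=
  elementAction (S := (ωB.mapMon.obj (extensionMonoid G γ)).X) a (fibreModule γ ωB M).X

lemma fibreMul_comp_extensionCharacter (a : 𝟙_ C ⟶ ωB.obj (γ.obj (G.obj (𝟙_ A')))) (g : Γ) :
    fibreMul γ ωB a ≫ extensionCharacter adj γ ωB ω' θ i g =
      extensionCharacter adj γ ωB ω' θ i g ≫ a ≫ extensionCharacter adj γ ωB ω' θ i g :=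
  elementMul_comp_char (S := (ωB.mapMon.obj (extensionMonoid G γ)).X) a
    (extensionCharacter adj γ ωB ω' θ i g)

omit [SymmetricCategory A'] in
lemma fibreAction_naturality (a : 𝟙_ C ⟶ ωB.obj (γ.obj (G.obj (𝟙_ A'))))
    {M N : UniversalExtension G γ} (f : M ⟶ N) :
    fibreAction γ ωB a M ≫ ωB.map f.hom = ωB.map f.hom ≫ fibreAction γ ωB a N :=
  elementAction_comp_hom (S := (ωB.mapMon.obj (extensionMonoid G γ)).X) a
    (X := (fibreModule γ ωB M).X) (Y := (fibreModule γ ωB N).X) (ωB.map f.hom)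
    (modMap_smul_hom ωB f)

lemma fibreAction_comp_pushforwardComponent (a : 𝟙_ C ⟶ ωB.obj (γ.obj (G.obj (𝟙_ A')))) (g : Γ)
    (X : A') :
    fibreAction γ ωB a (pushforwardModule G γ X) ≫
      pushforwardComponent adj γ ωB (ρ.pull g ⋙ ω') (translateComparison i γ ωB ω' θ g) X =
    pushforwardComponent adj γ ωB (ρ.pull g ⋙ ω') (translateComparison i γ ωB ω' θ g) X ≫
      unitScalar (a ≫ extensionCharacter adj γ ωB ω' θ i g) _ :=
  elementAction_comp_of_linear (S := (ωB.mapMon.obj (extensionMonoid G γ)).X) a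
    (X := (fibreModule γ ωB (pushforwardModule G γ X)).X)
    (extensionAugmentation adj γ ωB (ρ.pull g ⋙ ω') (translateComparison i γ ωB ω' θ g)) _
    (smul_pushforwardComponent adj γ ωB (ρ.pull g ⋙ ω') (translateComparison i γ ωB ω' θ g) X)

lemma fibreAction_comp_extensionProj [HasCoequalizers C]
    (a : 𝟙_ C ⟶ ωB.obj (γ.obj (G.obj (𝟙_ A')))) (M : UniversalExtension G γ) :
    fibreAction γ ωB a M ≫ extensionProj adj γ ωB ω' θ M =
      extensionProj adj γ ωB ω' θ M ≫ unitScalar (a ≫ extensionCharacter adj γ ωB ω' θ i 1) _ := by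
  rw [extensionCharacter_one]
  exact elementAction_extendScalarsProj (extensionAugmentation adj γ ωB ω' θ)
    (fibreModule γ ωB M) a

/-- Used for a = e_1: whatever vanishes in ω'_B(M) is killed by e_1 in ω_B(M). -/
lemma exists_extensionProj_comp_eq_fibreAction [HasCoequalizers C]
    (a : 𝟙_ C ⟶ ωB.obj (γ.obj (G.obj (𝟙_ A'))))
    (ha : fibreMul γ ωB a = extensionCharacter adj γ ωB ω' θ i 1 ≫ a)
    (M : UniversalExtension G γ) :
    ∃ q, extensionProj adj γ ωB ω' θ M ≫ q = fibreAction γ ωB a M := by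
  rw [extensionCharacter_one] at ha
  exact exists_extendScalarsProj_comp (extensionAugmentation adj γ ωB ω' θ)
    (fibreModule γ ωB M) _ (smul_elementAction (S := (ωB.mapMon.obj (extensionMonoid G γ)).X) a
      (extensionAugmentation adj γ ωB ω' θ) ha (fibreModule γ ωB M).X)

/-- e_g is the point of the product with coordinate 1 at g and 0 elsewhere. -/
lemma exists_extensionIdempotents [Fintype Γ] [DecidableEq Γ] [HasFiniteProducts A']
    (hcart : i.IsCartesian adj) [Preadditive C] [PreservesFiniteLimits ω'] :
    ∃ e : Γ → (𝟙_ C ⟶ ωB.obj (γ.obj (G.obj (𝟙_ A')))),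
      (∀ g h, e g ≫ extensionCharacter adj γ ωB ω' θ i h = if g = h then 𝟙 _ else 0) ∧
      ∑ g, extensionCharacter adj γ ωB ω' θ i g ≫ e g = 𝟙 _ := by
  have H := fun g => exists_unique_pushforwardComponents i adj γ ωB ω' θ hcart (𝟙_ A')
    (T := 𝟙_ C) (fun h => if g = h then Functor.LaxMonoidal.ε (ρ.pull h ⋙ ω') else 0)
  choose e he _ using H
  refine ⟨e, fun g h => ?_, ?_⟩
  · rw [extensionCharacter_eq, ← Category.assoc, he]
    split_ifs with hgh
    · simp
    · simp
  · refine (exists_unique_pushforwardComponents i adj γ ωB ω' θ hcart (𝟙_ A')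
      (T := ωB.obj (γ.obj (G.obj (𝟙_ A'))))
      (fun h => pushforwardComponent adj γ ωB (ρ.pull h ⋙ ω')
        (translateComparison i γ ωB ω' θ h) (𝟙_ A'))).unique (fun h => ?_) (fun h => ?_)
    · rw [Preadditive.sum_comp, Finset.sum_eq_single h]
      · rw [Category.assoc, he, if_pos rfl, extensionCharacter_eq, Category.assoc]
        simp
      · intro g _ hg
        rw [Category.assoc, he, if_neg hg, comp_zero]
      · simp
    · exact Category.id_comp _

/-- Both sides have the same coordinates, since χ_h(e_g x) = χ_h(e_g) χ_h(x) vanishes for h ≠ g. -/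
lemma fibreMul_idempotent [DecidableEq Γ] [HasFiniteProducts A'] [Finite Γ]
    (hcart : i.IsCartesian adj) [Preadditive C] [PreservesFiniteLimits ω']
    (e : Γ → (𝟙_ C ⟶ ωB.obj (γ.obj (G.obj (𝟙_ A')))))
    (he : ∀ g h, e g ≫ extensionCharacter adj γ ωB ω' θ i h = if g = h then 𝟙 _ else 0) (g : Γ) :
    fibreMul γ ωB (e g) = extensionCharacter adj γ ωB ω' θ i g ≫ e g := by
  refine (exists_unique_pushforwardComponents i adj γ ωB ω' θ hcart (𝟙_ A')
    (fun h => fibreMul γ ωB (e g) ≫ pushforwardComponent adj γ ωB (ρ.pull h ⋙ ω')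
      (translateComparison i γ ωB ω' θ h) (𝟙_ A'))).unique (fun h => rfl) (fun h => ?_)
  rw [← cancel_mono (Functor.OplaxMonoidal.η (ρ.pull h ⋙ ω')), Category.assoc, Category.assoc,
    Category.assoc, ← extensionCharacter_eq, fibreMul_comp_extensionCharacter, he]
  split_ifs with hg
  · rw [hg]
  · rw [comp_zero, comp_zero]

end ExtensionFunctor

/-! ### Faithfulness of `ω'_B` and connectedness of `B'` -/

section FibreFunctor

variable {A : Type u₁} [Category.{v₁} A] [MonoidalCategory A] [SymmetricCategory A]
  {A' : Type u₂} [Category.{v₂} A'] [MonoidalCategory A'] [SymmetricCategory A']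
  {B : Type u₃} [Category.{v₃} B] [Abelian B] [MonoidalCategory B] [SymmetricCategory B]
  [MonoidalPreadditive B]
  {L : Type w} [Field L]
  {F : A ⥤ A'} [F.Braided] {G : A' ⥤ A} [G.LaxMonoidal] (adj : F ⊣ G)
  [adj.IsMonoidal] (γ : A ⥤ B) [γ.Braided] (ωB : B ⥤ FGModuleCat.{w} L) [ωB.Braided]
  [ωB.Additive] [ωB.Faithful] [PreservesFiniteLimits ωB] [PreservesFiniteColimits ωB]
  (ω' : A' ⥤ FGModuleCat.{w} L) [ω'.Braided]
  (θ : γ ⋙ ωB ≅ F ⋙ ω') [NatTrans.IsMonoidal θ.hom]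

omit [ωB.Faithful] [PreservesFiniteLimits ωB] [PreservesFiniteColimits ωB] in
lemma extensionFunctor_map_zero (M N : UniversalExtension G γ) :
    (extensionFunctor adj γ ωB ω' θ).map (0 : M ⟶ N) = 0 := by
  rw [← cancel_epi (extensionProj adj γ ωB ω' θ M), extensionProj_naturality, comp_zero]
  exact (congrArg (fun t => t ≫ _) (ωB.map_zero _ _)).trans zero_comp

theorem isConnected_of_faithful (h : (extensionFunctor adj γ ωB ω' θ).Faithful) :
    UniversalExtension.IsConnected G γ := by
  obtain ⟨e⟩ := nonempty_extensionFunctor_unit_iso adj γ ωB ω' θ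
  set W := extensionFunctor adj γ ωB ω' θ with hW
  let T (r : UniversalExtension.unit G γ ⟶ UniversalExtension.unit G γ) :
      𝟙_ (FGModuleCat.{w} L) ⟶ 𝟙_ (FGModuleCat.{w} L) :=
    e.inv ≫ W.map r ≫ e.hom
  have hT (r) : W.map r = e.hom ≫ T r ≫ e.inv := by simp [T]
  have hT0 (r) (hr : T r = 0) : r = 0 := by
    apply W.map_injective
    rw [hT, hr, extensionFunctor_map_zero]
    simp
  refine (isField_end_iff _).2 ⟨fun h0 => ?_, fun r s => ?_, fun r => ?_⟩
  · have h1 : W.map (𝟙 (UniversalExtension.unit G γ)) = 0 := by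
      rw [h0, extensionFunctor_map_zero]
    apply FGModuleCat.unit_id_ne_zero (L := L)
    rw [← e.inv_hom_id, ← Category.id_comp e.hom, ← W.map_id, h1]
    simp
  · apply W.map_injective
    rw [W.map_comp, W.map_comp, hT r, hT s]
    simp only [Category.assoc, Iso.inv_hom_id_assoc]
    rw [reassoc_of% unit_end_comm (T r) (T s)]
  · rw [or_iff_not_imp_left]
    intro hr
    have h1 : IsIso (T r) := FGModuleCat.unit_end_isIso _ fun h0 => hr (hT0 r h0)
    have h2 : IsIso (W.map r) := by rw [hT]; infer_instance
    -- Faithfulness yields only a monomorphism here; invertibility then comes from the finite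
    -- dimension of ω_B(R).
    have h3 : Mono r := W.mono_of_mono_map inferInstance
    have h4 : Mono r.hom := mono_hom_of_mono r
    have h5 : IsIso (ωB.map r.hom) := FGModuleCat.isIso_of_mono_end (ωB.map r.hom)
    have h6 : IsIso r.hom := isIso_of_reflects_iso r.hom ωB
    exact isIso_of_isIso_hom r

theorem faithful_of_isConnected [RightRigidCategory B] {Γ : Type*} [Group Γ] [Fintype Γ]
    {ρ : TensorPseudoAction Γ A'} (i : TensorEquivariance ρ F) [HasFiniteProducts A']
    (hcart : i.IsCartesian adj) [PreservesFiniteLimits ω']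
    (h : UniversalExtension.IsConnected G γ) : (extensionFunctor adj γ ωB ω' θ).Faithful := by
  classical
  obtain ⟨e, he, hsum⟩ := exists_extensionIdempotents adj γ ωB ω' θ i hcart
  have hfield := ((isField_end_iff _).1 h).2.2
  refine ⟨fun {M N f g} hfg => ?_⟩
  rw [← sub_eq_zero]
  refine @hom_eq_zero_of_elementAction_eq_zero _ _ _ _ _ _ _ _ _ _ _
    FGModuleCat.isSeparator_unit FGModuleCat.unit_end_isIso ωB _ _ _ _ _
    (extensionMonoid G γ).X _ Γ _ _ (extensionCharacter adj γ ωB ω' θ i)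
    (extensionCharacter_isMonHom adj γ ωB ω' θ i) e he hsum hfield
    M N (f - g) 1 FGModuleCat.unit_id_ne_zero ?_
  change fibreAction γ ωB (e 1) M ≫ ωB.map (f - g).hom = 0
  obtain ⟨q, hq⟩ := exists_extensionProj_comp_eq_fibreAction adj γ ωB ω' θ i (e 1)
    (fibreMul_idempotent adj γ ωB ω' θ i hcart e he 1) N
  have h3 : ωB.map (f - g).hom ≫ extensionProj adj γ ωB ω' θ N = 0 := by
    have : (f - g).hom = f.hom - g.hom := by
      rw [sub_eq_add_neg, sub_eq_add_neg]
      rfl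
    rw [this, ωB.map_sub, Preadditive.sub_comp, sub_eq_zero]
    exact (extensionFunctor_map_eq_iff adj γ ωB ω' θ f g).1 hfg
  rw [fibreAction_naturality, ← hq, ← Category.assoc, h3, zero_comp]

end FibreFunctor

/-! ### Descent of invariant morphisms by the trace -/

section Descent

variable {Γ : Type*} [Group Γ] [Fintype Γ]
  {A : Type u₁} [Category.{v₁} A] [MonoidalCategory A] [SymmetricCategory A] [Preadditive A]
  {A' : Type u₂} [Category.{v₂} A'] [MonoidalCategory A'] [SymmetricCategory A'] [Preadditive A']
  {ρ : TensorPseudoAction Γ A'} {F : A ⥤ A'} [F.Braided] {G : A' ⥤ A}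

/-- A morphism `f^* X ⟶ f^* Y` which is invariant under `Γ` comes from a morphism `X ⟶ Y`. -/
lemma exists_map_eq_of_translate_eq (K : Type*) [Field K] [CharZero K] [Linear K A] [Linear K A']
    [F.Additive] [F.Linear K] (i : TensorEquivariance ρ F) (adj : F ⊣ G)
    (t : TraceStructure i adj) {X Y : A} (ψ : F.obj X ⟶ F.obj Y)
    (hψ : ∀ g, i.translate g ψ = ψ) : ∃ φ : X ⟶ Y, F.map φ = ψ := by
  have hc : (Fintype.card Γ : K) ≠ 0 := by simp
  -- Up to the factor 1/|Γ|, the image under f^* of tr ∘ f_*ψ ∘ η is the sum of the translates of ψ.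
  refine ⟨(Fintype.card Γ : K)⁻¹ • (adj.unit.app X ≫ G.map ψ ≫ t.tr.app Y), ?_⟩
  have h1 : F.map (adj.unit.app X) ≫ F.map (G.map ψ) ≫ adj.counit.app (F.obj Y) = ψ := by
    simp
  -- Naturality of i_g makes morphisms in the image of f^* invariant, so this composite is the
  -- translate by g of the one in `h1`, that is, ψ^g.
  have h2 (g : Γ) : F.map (adj.unit.app X) ≫ F.map (G.map ψ) ≫
      i.translate g (X := G.obj (F.obj Y)) (Y := Y) (adj.counit.app (F.obj Y)) = ψ := by
    conv_rhs => rw [← hψ g, ← h1]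
    have h3 := (i.iso g).inv.naturality (adj.unit.app X)
    have h4 := (i.iso g).inv.naturality (G.map ψ)
    simp only [Functor.comp_obj, Functor.comp_map] at h3 h4
    simp only [TensorEquivariance.translate, Functor.map_comp, Category.assoc]
    rw [← reassoc_of% h3, ← reassoc_of% h4]
  rw [F.map_smul, F.map_comp, F.map_comp, t.map_tr]
  simp only [Preadditive.comp_sum]
  rw [Finset.sum_congr rfl fun g _ => h2 g, Finset.sum_const, Finset.card_univ,
    ← Nat.cast_smul_eq_nsmul K, smul_smul, inv_mul_cancel₀ hc, one_smul]

end Descent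

/-! ### Lifting linear maps between sums of the unit -/

section FullOnSums

variable {A' : Type u₂} [Category.{v₂} A'] [MonoidalCategory A'] [Preadditive A']
  [HasFiniteBiproducts A'] {K : Type*} [Field K] [Linear K A']
  {L : Type w} [Field L] [Algebra K L]

omit [MonoidalCategory A'] in
lemma exists_decomposition_of_iso_biproduct {P X : A'} {m : ℕ} (p : P ≅ ⨁ fun _ : Fin m => X) :
    ∃ (pr : Fin m → (P ⟶ X)) (inc : Fin m → (X ⟶ P)), ∑ a, pr a ≫ inc a = 𝟙 P := by
  refine ⟨fun a => p.hom ≫ biproduct.π (fun _ => X) a,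
    fun a => biproduct.ι (fun _ => X) a ≫ p.inv, ?_⟩
  have h := biproduct.total (f := fun _ : Fin m => X)
  have h2 : p.hom ≫ (∑ a, biproduct.π (fun _ : Fin m => X) a ≫ biproduct.ι (fun _ => X) a) ≫
      p.inv = 𝟙 P := by rw [h]; simp
  rw [← h2, Preadditive.sum_comp, Preadditive.comp_sum]
  simp only [Category.assoc]

/-- The matrix entries of l lie in End(ω'(1)) = L, and each is the image of a scalar of K. -/
lemma exists_map_eq_of_iso_biproduct_unit (hKL : Function.Surjective (algebraMap K L))
    (ω' : A' ⥤ FGModuleCat.{w} L) [ω'.Monoidal] [ω'.Additive]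
    (hsmul : ∀ {X Y : A'} (k : K) (f : X ⟶ Y), ω'.map (k • f) = algebraMap K L k • ω'.map f)
    {P Q : A'} {m n : ℕ} (p : P ≅ ⨁ fun _ : Fin m => 𝟙_ A') (q : Q ≅ ⨁ fun _ : Fin n => 𝟙_ A')
    (l : ω'.obj P ⟶ ω'.obj Q) : ∃ ψ : P ⟶ Q, ω'.map ψ = l := by
  have h1 (c : ω'.obj (𝟙_ A') ⟶ ω'.obj (𝟙_ A')) : ∃ k : K, c = ω'.map (k • 𝟙 (𝟙_ A')) := by
    obtain ⟨x, hx⟩ := FGModuleCat.unit_end_eq_smul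
      (Functor.LaxMonoidal.ε ω' ≫ c ≫ Functor.OplaxMonoidal.η ω')
    obtain ⟨k, rfl⟩ := hKL x
    refine ⟨k, ?_⟩
    rw [hsmul, ω'.map_id, ← cancel_epi (Functor.LaxMonoidal.ε ω'),
      ← cancel_mono (Functor.OplaxMonoidal.η ω'), Category.assoc, hx]
    simp
  choose k hk using h1
  obtain ⟨pr, inc, hp⟩ := exists_decomposition_of_iso_biproduct p
  obtain ⟨pr', inc', hq⟩ := exists_decomposition_of_iso_biproduct q
  refine ⟨∑ b, ∑ a, pr a ≫ (k (ω'.map (inc a) ≫ l ≫ ω'.map (pr' b)) • 𝟙 _) ≫ inc' b, ?_⟩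
  conv_rhs => rw [← Category.id_comp l, ← Category.comp_id l, ← ω'.map_id, ← ω'.map_id, ← hp, ← hq]
  simp only [ω'.map_sum, Preadditive.sum_comp, Preadditive.comp_sum]
  refine Finset.sum_congr rfl fun b _ => Finset.sum_congr rfl fun a _ => ?_
  rw [ω'.map_comp, ω'.map_comp, ← hk, ω'.map_comp, ω'.map_comp]
  simp only [Category.assoc]

end FullOnSums

/-! ### Artin objects, and fullness implies connectedness -/

section Artin

variable {A : Type u₁} [Category.{v₁} A] [MonoidalCategory A] [SymmetricCategory A]
  {A' : Type u₂} [Category.{v₂} A'] [MonoidalCategory A'] [SymmetricCategory A'] [Preadditive A']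
  [HasFiniteProducts A'] {F : A ⥤ A'} [F.Braided]

lemma artinObjects_unit : artinObjects F (𝟙_ A) := by
  have : HasFiniteBiproducts A' := HasFiniteBiproducts.of_hasFiniteProducts
  exact ⟨1, ⟨(Functor.Monoidal.εIso F).symm ≪≫
    (biproductUniqueIso fun _ : Fin 1 => 𝟙_ A').symm⟩⟩

lemma artinObjects_pushforward_unit {G : A' ⥤ A} {Γ : Type*} [Group Γ] [Finite Γ]
    {ρ : TensorPseudoAction Γ A'} (i : TensorEquivariance ρ F) (adj : F ⊣ G)
    (hcart : i.IsCartesian adj) : artinObjects F (G.obj (𝟙_ A')) := by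
  have : HasFiniteBiproducts A' := HasFiniteBiproducts.of_hasFiniteProducts
  have := hcart (𝟙_ A')
  obtain ⟨n, ⟨e⟩⟩ := Finite.exists_equiv_fin Γ
  exact ⟨n, ⟨asIso (Pi.lift fun g : Γ => i.baseChangeComponent adj (𝟙_ A') g) ≪≫
    Pi.mapIso (fun g => (Functor.Monoidal.εIso (ρ.pull g)).symm) ≪≫
    (biproduct.isoProduct fun _ : Γ => 𝟙_ A').symm ≪≫
    biproduct.whiskerEquiv (f := fun _ : Γ => 𝟙_ A') (g := fun _ : Fin n => 𝟙_ A') e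
      fun _ => Iso.refl _⟩⟩

end Artin

section Fullness

variable {K : Type*} [Field K]
  {A : Type u₁} [Category.{v₁} A] [MonoidalCategory A] [SymmetricCategory A]
  {A' : Type u₂} [Category.{v₂} A'] [MonoidalCategory A'] [SymmetricCategory A']
  {B : Type u₃} [Category.{v₃} B] [MonoidalCategory B] [SymmetricCategory B]
  {F : A ⥤ A'} [F.Braided] {G : A' ⥤ A} [G.LaxMonoidal]

/-- If `End 𝟙 = K` in `A'`, then `Hom(𝟙, f_* 𝟙)` is spanned by the unit of the monoid `f_* 𝟙`. -/
lemma exists_eq_smul_pushforward_one [Preadditive A] [Linear K A] [Preadditive A'] [Linear K A']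
    [F.Additive] [F.Linear K] (adj : F ⊣ G) [adj.IsMonoidal]
    (hA' : Function.Surjective (algebraMap K (End (𝟙_ A'))))
    (w : 𝟙_ A ⟶ G.obj (𝟙_ A')) : ∃ k : K, w = k • Functor.LaxMonoidal.ε G := by
  obtain ⟨k, hk⟩ := hA' (Functor.LaxMonoidal.ε F ≫ F.map w ≫ adj.counit.app (𝟙_ A'))
  refine ⟨k, (adj.homEquiv _ _).symm.injective ?_⟩
  have h1 := NatTrans.IsMonoidal.unit (τ := adj.counit)
  rw [Adjunction.homEquiv_counit, Adjunction.homEquiv_counit, F.map_smul, Linear.smul_comp,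
    ← cancel_epi (Functor.LaxMonoidal.ε F), ← hk, Linear.comp_smul]
  simp at h1
  rw [h1]
  simp [Algebra.algebraMap_eq_smul_one]

/-- Every linear endomorphism of R is right multiplication by a multiple of 1, hence a scalar from
K. -/
lemma isField_end_regular_of_forall_smul {B : Type u₃} [Category.{v₃} B] [MonoidalCategory B]
    [Preadditive B] [MonoidalPreadditive B] [Linear K B]
    [MonoidalLinear K B] (R : B) [MonObj R] (hR : 𝟙 R ≠ 0)
    (h : ∀ z : 𝟙_ B ⟶ R, ∃ k : K, z = k • MonObj.one (X := R)) : IsField (End (Mod.regular R)) := by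
  have h1 (r : Mod.regular R ⟶ Mod.regular R) : ∃ k : K, (r.hom : R ⟶ R) = k • 𝟙 R := by
    obtain ⟨k, hk⟩ := h (show 𝟙_ B ⟶ R from MonObj.one (X := R) ≫ r.hom)
    refine ⟨k, ?_⟩
    rw [eq_regularEnd r, hk, regularEnd_hom]
    simp [elementRightMul, MonoidalLinear.whiskerLeft_smul]
    rfl
  refine (isField_end_iff _).2 ⟨fun h0 => hR (congrArg Mod.Hom.hom h0), fun r s => ?_, fun r => ?_⟩
  · obtain ⟨k, hk⟩ := h1 r
    obtain ⟨l, hl⟩ := h1 s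
    refine Mod.hom_ext _ _ ?_
    change (show R ⟶ R from r.hom) ≫ (show R ⟶ R from s.hom) =
      (show R ⟶ R from s.hom) ≫ (show R ⟶ R from r.hom)
    rw [hk, hl]
    simp [smul_smul, mul_comm]
  · obtain ⟨k, hk⟩ := h1 r
    by_cases hk0 : k = 0
    · left
      refine Mod.hom_ext _ _ ?_
      rw [hk, hk0, zero_smul]
      rfl
    · right
      have h2 : IsIso (k • 𝟙 R) :=
        ⟨k⁻¹ • 𝟙 R, by simp [hk0, smul_smul], by simp [hk0, smul_smul]⟩
      have : IsIso r.hom := by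
        rw [hk]
        exact h2
      exact isIso_of_isIso_hom r

theorem isConnected_of_full [Abelian B] [MonoidalPreadditive B] [Linear K B] [MonoidalLinear K B]
    [Preadditive A] [Linear K A] [Preadditive A'] [Linear K A'] [HasFiniteProducts A']
    [F.Additive] [F.Linear K] (adj : F ⊣ G) [adj.IsMonoidal]
    (hA' : Function.Surjective (algebraMap K (End (𝟙_ A'))))
    {Γ : Type*} [Group Γ] [Finite Γ] {ρ : TensorPseudoAction Γ A'} (i : TensorEquivariance ρ F)
    (hcart : i.IsCartesian adj) (γ : A ⥤ B) [γ.Braided] [γ.Additive] [γ.Linear K]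
    (hR : 𝟙 (γ.obj (G.obj (𝟙_ A'))) ≠ 0) (h : ((artinObjects F).ι ⋙ γ).Full) :
    UniversalExtension.IsConnected G γ := by
  refine isField_end_regular_of_forall_smul (K := K) (extensionMonoid G γ).X hR fun z => ?_
  -- Both 1 and f_*1 are Artin, so fullness lifts z to a morphism of A.
  obtain ⟨w, hw⟩ := h.map_surjective (X := ⟨𝟙_ A, artinObjects_unit⟩)
    (Y := ⟨G.obj (𝟙_ A'), artinObjects_pushforward_unit i adj hcart⟩)
    (Functor.OplaxMonoidal.η γ ≫ z)
  obtain ⟨k, hk⟩ := exists_eq_smul_pushforward_one adj hA' w.hom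
  have h1 : γ.map w.hom = Functor.OplaxMonoidal.η γ ≫ z := hw
  rw [hk, γ.map_smul] at h1
  have h2 : k • γ.map (Functor.LaxMonoidal.ε G) =
      Functor.OplaxMonoidal.η γ ≫ (k • (Functor.LaxMonoidal.ε γ ≫
        γ.map (Functor.LaxMonoidal.ε G ≫ G.map (𝟙 (𝟙_ A'))))) := by
    simp
  exact ⟨k, (cancel_epi (Z := γ.obj (G.obj (𝟙_ A'))) (Functor.OplaxMonoidal.η γ)).1
    (h1.symm.trans h2)⟩

end Fullness

/-! ### Faithfulness of `ω'_B` implies invariance under Γ -/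

section Comparison

variable {A : Type u₁} [Category.{v₁} A] [MonoidalCategory A] [SymmetricCategory A]
  {A' : Type u₂} [Category.{v₂} A'] [MonoidalCategory A'] [SymmetricCategory A']
  {B : Type u₃} [Category.{v₃} B] [MonoidalCategory B] [SymmetricCategory B]
  {C : Type u₄} [Category.{v₄} C] [MonoidalCategory C] [SymmetricCategory C]
  {F : A ⥤ A'} [F.Braided] {G : A' ⥤ A} [G.LaxMonoidal] (adj : F ⊣ G)
  [adj.IsMonoidal] (γ : A ⥤ B) [γ.Braided] (ωB : B ⥤ C) [ωB.Braided]
  (ω' : A' ⥤ C) [ω'.Braided]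
  (θ : γ ⋙ ωB ≅ F ⋙ ω') [NatTrans.IsMonoidal θ.hom] {Γ : Type*} [Group Γ]
  {ρ : TensorPseudoAction Γ A'} (i : TensorEquivariance ρ F)

lemma smul_extensionProj [HasCoequalizers C] (M : UniversalExtension G γ) :
    Functor.LaxMonoidal.μ ωB (extensionMonoid G γ).X M.X ≫
      ωB.map (ModObj.smul (M := (extensionMonoid G γ).X) (X := M.X)) ≫
        extensionProj adj γ ωB ω' θ M =
    (show ωB.obj (extensionMonoid G γ).X ⟶ 𝟙_ C from extensionAugmentation adj γ ωB ω' θ) ▷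
      ωB.obj M.X ≫ (λ_ (ωB.obj M.X)).hom ≫ extensionProj adj γ ωB ω' θ M :=
  (Category.assoc _ _ _).symm.trans
    (smul_extendScalarsProj (extensionAugmentation adj γ ωB ω' θ) (fibreModule γ ωB M))

/-- Faithfulness concerns module morphisms, so u and v are first extended to R ⊗ X → M; the image of
such an extension under ω'_B depends only on u followed by the projection. -/
lemma eq_of_map_comp_extensionProj_eq [HasCoequalizers C]
    (h : (extensionFunctor adj γ ωB ω' θ).Faithful) {X : B} {M : UniversalExtension G γ}
    (u v : X ⟶ M.X) (huv : ωB.map u ≫ extensionProj adj γ ωB ω' θ M =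
      ωB.map v ≫ extensionProj adj γ ωB ω' θ M) : u = v := by
  apply freeModuleDesc_injective M
  apply (extensionFunctor adj γ ωB ω' θ).map_injective
  rw [extensionFunctor_map_eq_iff]
  have key (u : X ⟶ M.X) : ωB.map (freeModuleDesc M u).hom ≫ extensionProj adj γ ωB ω' θ M =
      Functor.OplaxMonoidal.δ ωB (extensionMonoid G γ).X X ≫
        (show ωB.obj (extensionMonoid G γ).X ⟶ 𝟙_ C from extensionAugmentation adj γ ωB ω' θ) ▷
          ωB.obj X ≫ (λ_ (ωB.obj X)).hom ≫ ωB.map u ≫ extensionProj adj γ ωB ω' θ M := by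
    change ωB.map ((extensionMonoid G γ).X ◁ u ≫
      ModObj.smul (M := (extensionMonoid G γ).X) (X := M.X)) ≫ extensionProj adj γ ωB ω' θ M = _
    rw [Functor.map_comp, Functor.Monoidal.map_whiskerLeft]
    simp only [Category.assoc]
    rw [smul_extensionProj, whisker_exchange_assoc, leftUnitor_naturality_assoc]
  rw [key, key, huv]

/-- The projection from `ωB γ f_* X` to the image of the module `γ(f_* X)` under `ω'_B`. -/
def pushforwardProj [HasCoequalizers C] (X : A') : ωB.obj (γ.obj (G.obj X)) ⟶
    (extensionFunctor adj γ ωB ω' θ).obj (pushforwardModule G γ X) :=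
  extensionProj adj γ ωB ω' θ (pushforwardModule G γ X)

/-- The projection to ω'_B absorbs the action of e_1, which kills every coordinate except the one of
index 1. -/
lemma comp_pushforwardProj_eq [HasCoequalizers C] [Fintype Γ]
    [HasFiniteProducts A'] [Preadditive C] [MonoidalPreadditive C] [PreservesFiniteLimits ω']
    (hcart : i.IsCartesian adj) {T : C} {X : A'} (s t : T ⟶ ωB.obj (γ.obj (G.obj X)))
    (hst : s ≫ pushforwardComponent adj γ ωB ω' θ X = t ≫ pushforwardComponent adj γ ωB ω' θ X) :
    s ≫ pushforwardProj adj γ ωB ω' θ X = t ≫ pushforwardProj adj γ ωB ω' θ X := by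
  classical
  obtain ⟨e, he, -⟩ := exists_extensionIdempotents adj γ ωB ω' θ i hcart
  obtain ⟨α, h1, h2⟩ : ∃ α : ωB.obj (γ.obj (G.obj X)) ⟶ ωB.obj (γ.obj (G.obj X)),
      pushforwardProj adj γ ωB ω' θ X = α ≫ pushforwardProj adj γ ωB ω' θ X ∧
      ∀ g, α ≫ pushforwardComponent adj γ ωB (ρ.pull g ⋙ ω')
          (translateComparison i γ ωB ω' θ g) X =
        pushforwardComponent adj γ ωB (ρ.pull g ⋙ ω') (translateComparison i γ ωB ω' θ g) X ≫
          unitScalar (e 1 ≫ extensionCharacter adj γ ωB ω' θ i g) _ :=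
    ⟨fibreAction γ ωB (e 1) (pushforwardModule G γ X), by
      have h := fibreAction_comp_extensionProj adj γ ωB ω' θ i (e 1) (pushforwardModule G γ X)
      rw [he, if_pos rfl, unitScalar_id, Category.comp_id] at h
      exact h.symm, fun g => fibreAction_comp_pushforwardComponent adj γ ωB ω' θ i (e 1) g X⟩
  have h3 : s ≫ α = t ≫ α := by
    refine (exists_unique_pushforwardComponents i adj γ ωB ω' θ hcart X
      (fun g => (s ≫ α) ≫ pushforwardComponent adj γ ωB (ρ.pull g ⋙ ω')
          (translateComparison i γ ωB ω' θ g) X)).unique (fun g => rfl) (fun g => ?_)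
    rw [Category.assoc, Category.assoc, h2, he]
    split_ifs with hg
    · subst hg
      rw [translate_one_pushforwardComponent, Category.assoc, reassoc_of% hst]
    · rw [unitScalar_zero, comp_zero, comp_zero, comp_zero]
  rw [h1, reassoc_of% h3]

/-- If `ω'_B` is faithful and the image under `ω'` of `ψ : f^* X ⟶ f^* Y` is the image under `ωB`
of a morphism `γ X ⟶ γ Y`, then `ψ` is invariant under `Γ`. -/
lemma translate_eq_of_map_eq [HasCoequalizers C] [Fintype Γ]
    [HasFiniteProducts A'] [Preadditive C] [MonoidalPreadditive C] [PreservesFiniteLimits ω']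
    [ω'.Faithful] (hcart : i.IsCartesian adj) (h : (extensionFunctor adj γ ωB ω' θ).Faithful)
    {X Y : A} (φ : γ.obj X ⟶ γ.obj Y) (ψ : F.obj X ⟶ F.obj Y)
    (hψ : θ.hom.app X ≫ ω'.map ψ = ωB.map φ ≫ θ.hom.app Y) (g : Γ) :
    i.translate g ψ = ψ := by
  obtain ⟨u, hu⟩ : ∃ u : Y ⟶ G.obj (F.obj Y), F.map u ≫ adj.counit.app (F.obj Y) = 𝟙 _ :=
    ⟨adj.unit.app Y, by simp⟩
  obtain ⟨v, hv⟩ : ∃ v : X ⟶ G.obj (F.obj Y), F.map v ≫ adj.counit.app (F.obj Y) = ψ :=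
    ⟨adj.homEquiv _ _ ψ, by simp [Adjunction.homEquiv_unit]⟩
  -- After ω_B the two morphisms have the same coordinate at index 1, namely ψ up to θ; faithfulness
  -- of ω'_B turns this into an equality in B.
  have huv : φ ≫ γ.map u = γ.map v := by
    refine eq_of_map_comp_extensionProj_eq adj γ ωB ω' θ h
      (M := pushforwardModule G γ (F.obj Y)) _ _
      (comp_pushforwardProj_eq adj γ ωB ω' θ i hcart (ωB.map (φ ≫ γ.map u)) (ωB.map (γ.map v)) ?_)
    rw [ωB.map_comp, Category.assoc, map_comp_pushforwardComponent, map_comp_pushforwardComponent,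
      hu, hv, hψ, ω'.map_id]
    exact congrArg (fun t => ωB.map φ ≫ t) (Category.comp_id _)
  -- Reading the same equality at the coordinate g compares ψ with g^*ψ through i_g.
  have h1 := congr(ωB.map $huv ≫ pushforwardComponent adj γ ωB (ρ.pull g ⋙ ω')
    (translateComparison i γ ωB ω' θ g) (F.obj Y))
  rw [ωB.map_comp, Category.assoc, map_comp_pushforwardComponent, map_comp_pushforwardComponent,
    hu, hv, translateComparison_hom_app, translateComparison_hom_app, Category.assoc,
    ← reassoc_of% hψ] at h1
  have h2 : (i.iso g).inv.app X ≫ (ρ.pull g).map ψ = ψ ≫ (i.iso g).inv.app Y := by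
    apply ω'.map_injective
    rw [← cancel_epi (θ.hom.app X)]
    simpa using h1.symm
  rw [TensorEquivariance.translate, reassoc_of% h2]
  simp

end Comparison

/-! ### The three statements -/

theorem propositionp4p3
    {K : Type*} [Field K] [CharZero K] {L : Type w} [Field L] [Algebra K L]
    {Γ : Type*} [Group Γ] [Fintype Γ]
    -- the rigid abelian tensor categories `A`, `A'` with `End(𝟙) = K`
    {A : Type u₁} [Category.{v₁} A] [Abelian A] [MonoidalCategory A] [SymmetricCategory A]
    [MonoidalPreadditive A] [Linear K A] [MonoidalLinear K A] [RigidCategory A]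
    (hA : Function.Bijective (algebraMap K (End (𝟙_ A))))
    {A' : Type u₂} [Category.{v₂} A'] [Abelian A'] [MonoidalCategory A'] [SymmetricCategory A']
    [MonoidalPreadditive A'] [Linear K A'] [MonoidalLinear K A'] [RigidCategory A']
    (hA' : Function.Bijective (algebraMap K (End (𝟙_ A'))))
    -- the action of `Γ` on `A'`, the functor `F = f^*` and its right adjoint `G = f_*`
    (ρ : TensorPseudoAction Γ A')
    (F : A ⥤ A') [F.Braided] [F.Additive] [F.Linear K] (i : TensorEquivariance ρ F)
    (G : A' ⥤ A) [G.LaxMonoidal] (adj : F ⊣ G) [adj.IsMonoidal]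
    (hcart : i.IsCartesian adj) (htr : Nonempty (TraceStructure i adj))
    -- the enrichment `γ : A ⥤ B`, `ωB : B ⥤ Vec_L`
    {B : Type u₃} [Category.{v₃} B] [Abelian B] [MonoidalCategory B] [SymmetricCategory B]
    [MonoidalPreadditive B] [Linear K B] [MonoidalLinear K B] [RigidCategory B]
    (hB : Function.Bijective (algebraMap K (End (𝟙_ B))))
    (γ : A ⥤ B) [γ.Braided] [γ.Additive] [γ.Linear K] [γ.Faithful]
    [PreservesFiniteLimits γ] [PreservesFiniteColimits γ]
    (ωB : B ⥤ FGModuleCat.{w} L) [ωB.Braided] (hωB : IsFibreFunctor K ωB)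
    -- the fibre functor `ω'` on `A'` extending `ω = ωB γ`
    (ω' : A' ⥤ FGModuleCat.{w} L) [ω'.Braided] (hω' : IsFibreFunctor K ω')
    (θ : γ ⋙ ωB ≅ F ⋙ ω') [NatTrans.IsMonoidal θ.hom] :
    ((extensionFunctor adj γ ωB ω' θ).Faithful ↔ UniversalExtension.IsConnected G γ) ∧
    (((artinObjects F).ι ⋙ γ).Full → (extensionFunctor adj γ ωB ω' θ).Faithful) ∧
    (Function.Bijective (algebraMap K L) → (extensionFunctor adj γ ωB ω' θ).Faithful →
      ((artinObjects F).ι ⋙ γ).Full) := by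
  have := hωB.additive
  have := hωB.faithful
  have := hωB.exact_left
  have := hωB.exact_right
  have := hω'.additive
  have := hω'.faithful
  have := hω'.exact_left
  -- The idempotent e_1 is a nonzero point of ω_B(R), since χ_1(e_1) = 1.
  have hR : 𝟙 (γ.obj (G.obj (𝟙_ A'))) ≠ 0 := by
    classical
    obtain ⟨e, he, -⟩ := exists_extensionIdempotents adj γ ωB ω' θ i hcart
    intro h0
    have h1 : e 1 = 0 := by
      rw [← Category.comp_id (e 1), ← ωB.map_id, h0, ωB.map_zero, comp_zero]
    have h2 := he 1 1
    rw [h1, zero_comp, if_pos rfl] at h2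
    exact FGModuleCat.unit_id_ne_zero h2.symm
  refine ⟨⟨isConnected_of_faithful adj γ ωB ω' θ, faithful_of_isConnected adj γ ωB ω' θ i hcart⟩,
    fun h => faithful_of_isConnected adj γ ωB ω' θ i hcart
      (isConnected_of_full adj hA'.surjective i hcart γ hR h), fun hKL h => ⟨fun {X Y} φ => ?_⟩⟩
  have : HasFiniteBiproducts A' := HasFiniteBiproducts.of_hasFiniteProducts
  obtain ⟨m, ⟨p⟩⟩ := X.property
  obtain ⟨n, ⟨q⟩⟩ := Y.property
  -- Because L = K, the linear map ω_B(φ), transported by θ, comes from a morphism between the sums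
  -- of units f^*X and f^*Y.
  obtain ⟨ψ, hψ⟩ := exists_map_eq_of_iso_biproduct_unit hKL.surjective ω' hω'.map_smul p q
    (θ.inv.app X.obj ≫ ωB.map φ ≫ θ.hom.app Y.obj)
  obtain ⟨t⟩ := htr
  obtain ⟨φ', hφ'⟩ := exists_map_eq_of_translate_eq K i adj t ψ
    (translate_eq_of_map_eq adj γ ωB ω' θ i hcart h φ ψ (by rw [hψ]; simp))
  refine ⟨ObjectProperty.homMk φ', ωB.map_injective ?_⟩
  change ωB.map (γ.map φ') = ωB.map φ
  have h1 := θ.hom.naturality φ'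
  simp only [Functor.comp_map, hφ', hψ, Iso.hom_inv_id_app_assoc] at h1
  exact (cancel_mono (θ.hom.app Y.obj)).1 h1

end
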